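/- Let $R$ be a commutative ring with unit, and let $H^*(X)=H^*(X;R)$ denote singular cohomology, with cochain multiplication $\bullet$ on $C^*(X)=C^*(X;R)$. Let $B$ be a path-connected space, $E$ a non-empty space and $p\colon E\to B$ a (Hurewicz) fibration. The *Schwarz genus* $\mathrm{genus}(p)\in\{0,1,2,\dots\}\cup\{\infty\}$ is the least $k$ such that $B$ is covered by open sets $U_1,\dots,U_k$ on each of which $p$ has a continuous local section ($\infty$ if there is no such $k$). The *weight* of a non-zero class $u\in H^n(B)$ with respect to $p$ is $$\mathrm{wgt}_p(u)=\sup\{k\ge 0\mid f^*(u)=0\text{ for all spaces }A\text{ and all maps }f\colon A\to B\text{ with }\mathrm{genus}(f^*p)\le k\},$$ where $f^*p$ is the pull-back of $p$ along $f$. For $\alpha\in H^i(B)$, $\beta\in H^j(B)$, $\gamma\in H^k(B)$ the *Massey product* $\langle\alpha,\beta,\gamma\rangle$ is defined if $\alpha\beta=0=\beta\gamma$, and it is then the set of all classes $$[a\bullet\lambda+(-1)^{i+1}\mu\bullet c]\in H^{i+j+k-1}(B),$$ where $a,b,c$ are cocycles representing $\alpha,\beta,\gamma$, and $\mu\in C^{i+j-1}(B)$,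 $\lambda\in C^{j+k-1}(B)$ are cochains with $d\mu=a\bullet b$ and $d\lambda=b\bullet c$. **Theorem.** Let $\alpha\in H^i(B)$, $\beta\in H^j(B)$, $\gamma\in H^k(B)$, where $i,j,k\ge 0$. If $\langle\alpha,\beta,\gamma\rangle$ is defined and $0\notin\langle\alpha,\beta,\gamma\rangle$ (so that, in particular, $\alpha,\beta,\gamma$ are non-zero), then $$\mathrm{genus}(p)>\mathrm{wgt}_p(\beta)+\min\{\mathrm{wgt}_p(\alpha),\mathrm{wgt}_p(\gamma)\}.$$ (In particular the right-hand side is finite, also when $\mathrm{genus}(p)=\infty$.) -/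

import Mathlib

universe u v

namespace MasseyGenus

/-! ### Singular cochains -/

/-- Singular `n`-simplices of a space `X`: continuous maps from the standard topological
`n`-simplex (with vertices `0, …, n`) to `X`. -/
abbrev SingularSimplex (X : Type u) [TopologicalSpace X] (n : ℕ) : Type u :=
  C(stdSimplex ℝ (Fin (n + 1)), X)

/-- The affine map of standard simplices induced by a map of vertices. -/
noncomputable def simplexMap {m n : ℕ} (f : Fin (m + 1) → Fin (n + 1)) :
    C(stdSimplex ℝ (Fin (m + 1)), stdSimplex ℝ (Fin (n + 1))) :=
  ⟨stdSimplex.map f, stdSimplex.continuous_map f⟩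

lemma simplexMap_comp {l m n : ℕ} (f : Fin (m + 1) → Fin (n + 1))
    (g : Fin (l + 1) → Fin (m + 1)) :
    (simplexMap f).comp (simplexMap g) = simplexMap (f ∘ g) := by
  ext x : 1
  exact stdSimplex.map_comp_apply g f x

/-- The front face `0 < 1 < ⋯ < i` of the `n`-simplex, for `i ≤ n`
(the minimum only serves to make the expression total). -/
def frontVertices (i n : ℕ) (t : Fin (i + 1)) : Fin (n + 1) :=
  ⟨min t n, by omega⟩

/-- The back face `n - j < ⋯ < n` of the `n`-simplex, for `j ≤ n`
(the minimum only serves to make the expression total). -/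
def backVertices (j n : ℕ) (t : Fin (j + 1)) : Fin (n + 1) :=
  ⟨min (n - j + t) n, by omega⟩

/-- The total object `C^*(X; R)` of singular cochains: a family, indexed by `n`, of functions
on singular `n`-simplices. The group `C^k(X; R)` is its degree `k` part `Cochains.deg`. -/
abbrev Cochains (R : Type v) (X : Type u) [TopologicalSpace X] : Type (max u v) :=
  ∀ n : ℕ, SingularSimplex X n → R

namespace Cochains

variable {R : Type v} [CommRing R] {X : Type u} [TopologicalSpace X]

/-- The cochains of degree `k`, that is `C^k(X; R)`; this is zero for `k < 0`. -/
def deg (R : Type v) [CommRing R] (X : Type u) [TopologicalSpace X] (k : ℤ) :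
    Submodule R (Cochains R X) where
  carrier := {c | ∀ n : ℕ, (n : ℤ) ≠ k → c n = 0}
  add_mem' {a b} ha hb n hn := by simp [ha n hn, hb n hn]
  zero_mem' n hn := rfl
  smul_mem' r a ha n hn := by simp [ha n hn]

/-- The differential `(d c)(σ) = ∑ₖ (-1)ᵏ c(∂ₖ σ)`. -/
noncomputable def d : Cochains R X →ₗ[R] Cochains R X where
  toFun c n := match n with
    | 0 => 0
    | m + 1 => fun σ => ∑ k : Fin (m + 2),
        (-1) ^ (k : ℕ) * c m (σ.comp (simplexMap (Fin.succAbove k)))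
  map_add' a b := by
    funext n σ
    cases n with
    | zero => simp
    | succ m => simp [mul_add, Finset.sum_add_distrib]
  map_smul' r a := by
    funext n σ
    cases n with
    | zero => simp
    | succ m => simp [Finset.mul_sum, mul_left_comm]

/-- The cochain multiplication `(a • b)(σ) = ∑_{i + j = n} a(front i-face of σ) b(back j-face of σ)`
on an `n`-simplex `σ`; for `a`, `b` of degrees `i`, `j` only one summand is non-zero. -/
noncomputable def cup : Cochains R X →ₗ[R] Cochains R X →ₗ[R] Cochains R X :=
  LinearMap.mk₂ R
    (fun a b n σ => ∑ x ∈ Finset.HasAntidiagonal.antidiagonal n,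
      a x.1 (σ.comp (simplexMap (frontVertices x.1 n))) *
        b x.2 (σ.comp (simplexMap (backVertices x.2 n))))
    (fun a a' b => by funext n σ; simp [add_mul, Finset.sum_add_distrib])
    (fun r a b => by funext n σ; simp [Finset.mul_sum, mul_assoc])
    (fun a b b' => by funext n σ; simp [mul_add, Finset.sum_add_distrib])
    (fun r a b => by funext n σ; simp [Finset.mul_sum, mul_left_comm])

lemma d_succ (c : Cochains R X) (m : ℕ) (σ : SingularSimplex X (m + 1)) :
    d c (m + 1) σ = ∑ k : Fin (m + 2),
      (-1) ^ (k : ℕ) * c m (σ.comp (simplexMap (Fin.succAbove k))) := rfl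

lemma d_zero (c : Cochains R X) : d c 0 = 0 := rfl

lemma cup_apply (a b : Cochains R X) (n : ℕ) (σ : SingularSimplex X n) :
    cup a b n σ = ∑ x ∈ Finset.HasAntidiagonal.antidiagonal n,
      a x.1 (σ.comp (simplexMap (frontVertices x.1 n))) *
        b x.2 (σ.comp (simplexMap (backVertices x.2 n))) := rfl

lemma cup_mem_deg {p q : ℤ} {a b : Cochains R X} (ha : a ∈ deg R X p) (hb : b ∈ deg R X q) :
    cup a b ∈ deg R X (p + q) := by
  intro n hn
  funext σ
  rw [cup_apply]
  refine Finset.sum_eq_zero fun x hx => ?_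
  rw [Finset.HasAntidiagonal.mem_antidiagonal] at hx
  by_cases h : (x.1 : ℤ) = p
  · have : (x.2 : ℤ) ≠ q := by omega
    simp [hb _ this]
  · simp [ha _ h]

/-- An alternating sum splits at position `i`, up to two terms that cancel. -/
lemma alternating_split (i j : ℕ) (F G H : ℕ → R)
    (h₁ : ∀ k, k ≤ i → F k = G k) (h₂ : ∀ k, k ≤ j → F (i + 1 + k) = H (k + 1))
    (h₃ : G (i + 1) = H 0) :
    ∑ k ∈ Finset.range (i + j + 2), (-1) ^ k * F k =
      ∑ k ∈ Finset.range (i + 2), (-1) ^ k * G k +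
        (-1) ^ i * ∑ k ∈ Finset.range (j + 2), (-1) ^ k * H k := by
  have e : i + j + 2 = (i + 1) + (j + 1) := by ring
  rw [e, Finset.sum_range_add, Finset.sum_range_succ _ (i + 1), Finset.sum_range_succ' _ (j + 1),
    h₃, mul_add, Finset.mul_sum]
  have e₁ : ∑ k ∈ Finset.range (i + 1), (-1) ^ k * F k =
      ∑ k ∈ Finset.range (i + 1), (-1) ^ k * G k :=
    Finset.sum_congr rfl fun k hk => by
      rw [h₁ k (by rw [Finset.mem_range] at hk; omega)]
  have e₂ : ∑ k ∈ Finset.range (j + 1), (-1) ^ (i + 1 + k) * F (i + 1 + k) =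
      ∑ k ∈ Finset.range (j + 1), (-1) ^ i * ((-1) ^ (k + 1) * H (k + 1)) :=
    Finset.sum_congr rfl fun k hk => by
      rw [h₂ k (by rw [Finset.mem_range] at hk; omega)]
      ring
  rw [e₁, e₂]
  ring

/-- The `k`-th face inclusion, with `k` a natural number. -/
def faceVertices (n k : ℕ) (t : Fin (n + 1)) : Fin (n + 2) :=
  ⟨if (t : ℕ) < k then t else t + 1, by split <;> omega⟩

lemma face_front_of_le {i j k : ℕ} (hk : k ≤ i) :
    faceVertices (i + j) k ∘ frontVertices i (i + j) =
      frontVertices (i + 1) (i + j + 1) ∘ faceVertices i k := by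
  funext t
  ext
  grind [faceVertices, frontVertices, backVertices]

lemma face_back_of_le {i j k : ℕ} (hk : k ≤ i) :
    faceVertices (i + j) k ∘ backVertices j (i + j) = backVertices j (i + j + 1) := by
  funext t
  ext
  grind [faceVertices, frontVertices, backVertices]

lemma face_front_of_lt {i j k : ℕ} (hk : i < k) :
    faceVertices (i + j) k ∘ frontVertices i (i + j) = frontVertices i (i + j + 1) := by
  funext t
  ext
  grind [faceVertices, frontVertices, backVertices]

lemma face_back {i j k : ℕ} :
    faceVertices (i + j) (i + 1 + k) ∘ backVertices j (i + j) =
      backVertices (j + 1) (i + j + 1) ∘ faceVertices j (k + 1) := by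
  funext t
  ext
  grind [faceVertices, frontVertices, backVertices]

lemma front_face_last {i j : ℕ} :
    frontVertices (i + 1) (i + j + 1) ∘ faceVertices i (i + 1) = frontVertices i (i + j + 1) := by
  funext t
  ext
  grind [faceVertices, frontVertices, backVertices]

lemma back_face_zero {i j : ℕ} :
    backVertices (j + 1) (i + j + 1) ∘ faceVertices j 0 = backVertices j (i + j + 1) := by
  funext t
  ext
  grind [faceVertices, frontVertices, backVertices]

lemma succAbove_eq_faceVertices (n : ℕ) (k : Fin (n + 2)) :
    Fin.succAbove k = faceVertices n k := by
  funext t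
  ext
  simp only [Fin.succAbove, faceVertices, Fin.lt_def, Fin.val_castSucc]
  split <;> rfl

lemma d_succ_range (c : Cochains R X) (m : ℕ) (σ : SingularSimplex X (m + 1)) :
    d c (m + 1) σ = ∑ k ∈ Finset.range (m + 2),
      (-1) ^ k * c m (σ.comp (simplexMap (faceVertices m k))) := by
  rw [d_succ, Finset.sum_range]
  simp only [succAbove_eq_faceVertices]

/-- The Leibniz rule for not necessarily homogeneous cochains. -/
lemma d_cup_total (a b : Cochains R X) :
    d (cup a b) = cup (d a) b + cup (fun n σ => (-1) ^ n * a n σ) (d b) := by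
  funext n σ
  cases n with
  | zero => simp [d_zero, cup_apply]
  | succ m =>
    rw [d_succ_range, Pi.add_apply, Pi.add_apply, cup_apply, cup_apply,
      Finset.Nat.sum_antidiagonal_succ, Finset.Nat.sum_antidiagonal_succ']
    simp only [d_zero, Pi.zero_apply, zero_mul, mul_zero, zero_add, cup_apply,
      Finset.mul_sum, d_succ_range]
    rw [Finset.sum_comm, ← Finset.sum_add_distrib]
    refine Finset.sum_congr rfl fun x hx => ?_
    obtain ⟨i, j⟩ := x
    rw [Finset.HasAntidiagonal.mem_antidiagonal] at hx
    dsimp only at hx ⊢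
    subst hx
    have key := alternating_split (R := R) i j
      (fun k => a i ((σ.comp (simplexMap (faceVertices (i + j) k))).comp
          (simplexMap (frontVertices i (i + j)))) *
        b j ((σ.comp (simplexMap (faceVertices (i + j) k))).comp
          (simplexMap (backVertices j (i + j)))))
      (fun k => a i ((σ.comp (simplexMap (frontVertices (i + 1) (i + j + 1)))).comp
          (simplexMap (faceVertices i k))) *
        b j (σ.comp (simplexMap (backVertices j (i + j + 1)))))
      (fun k => a i (σ.comp (simplexMap (frontVertices i (i + j + 1)))) *
        b j ((σ.comp (simplexMap (backVertices (j + 1) (i + j + 1)))).comp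
          (simplexMap (faceVertices j k))))
      ?_ ?_ ?_
    · rw [key, Finset.sum_mul, Finset.mul_sum]
      congr 1
      · exact Finset.sum_congr rfl fun k _ => by ring
      · exact Finset.sum_congr rfl fun k _ => by ring
    · intro k hk
      simp only [ContinuousMap.comp_assoc, simplexMap_comp]
      rw [face_front_of_le hk, face_back_of_le hk]
    · intro k hk
      simp only [ContinuousMap.comp_assoc, simplexMap_comp]
      rw [face_front_of_lt (by omega), face_back]
    · simp only [ContinuousMap.comp_assoc, simplexMap_comp]
      rw [front_face_last, back_face_zero]

/-- The Leibniz rule `d(a • b) = da • b + (-1)^{|a|} a • db`. -/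
lemma d_cup {p : ℕ} {a : Cochains R X} (ha : a ∈ deg R X p) (b : Cochains R X) :
    d (cup a b) = cup (d a) b + (-1 : R) ^ p • cup a (d b) := by
  have h : (fun n σ => (-1) ^ n * a n σ : Cochains R X) = (-1 : R) ^ p • a := by
    funext n σ
    by_cases h : (n : ℤ) = p
    · have : n = p := by exact_mod_cast h
      subst this
      rfl
    · simp [ha _ h]
  rw [d_cup_total, h, map_smul, LinearMap.smul_apply]

/-- The cocycles of degree `k`. -/
noncomputable def cocycles (R : Type v) [CommRing R] (X : Type u) [TopologicalSpace X] (k : ℤ) :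
    Submodule R (Cochains R X) :=
  deg R X k ⊓ LinearMap.ker d

/-- The coboundaries of degree `k`: the image under `d` of the cochains of degree `k - 1`. -/
noncomputable def coboundaries (R : Type v) [CommRing R] (X : Type u) [TopologicalSpace X]
    (k : ℤ) : Submodule R (Cochains R X) :=
  (deg R X (k - 1)).map d

lemma cup_mem_cocycles {p q : ℕ} {a b : Cochains R X} (ha : a ∈ cocycles R X p)
    (hb : b ∈ cocycles R X q) : cup a b ∈ cocycles R X (p + q) := by
  refine ⟨cup_mem_deg ha.1 hb.1, ?_⟩
  have h₁ : d a = 0 := ha.2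
  have h₂ : d b = 0 := hb.2
  change d (cup a b) = 0
  rw [d_cup ha.1, h₁, h₂]
  simp

lemma cup_mem_coboundaries_left {p q : ℕ} {a b : Cochains R X} (ha : a ∈ coboundaries R X p)
    (hb : b ∈ cocycles R X q) : cup a b ∈ coboundaries R X (p + q) := by
  obtain ⟨e, he, rfl⟩ := ha
  have h₂ : d b = 0 := hb.2
  refine ⟨cup e b, ?_, ?_⟩
  · have := cup_mem_deg he hb.1
    rwa [sub_add_eq_add_sub] at this
  · rw [d_cup_total, h₂]
    simp

lemma cup_mem_coboundaries_right {p q : ℕ} {a b : Cochains R X} (ha : a ∈ cocycles R X p)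
    (hb : b ∈ coboundaries R X q) : cup a b ∈ coboundaries R X (p + q) := by
  obtain ⟨e, he, rfl⟩ := hb
  have h₁ : d a = 0 := ha.2
  refine ⟨(-1 : R) ^ p • cup a e, Submodule.smul_mem _ _ ?_, ?_⟩
  · have := cup_mem_deg ha.1 he
    rwa [← add_sub_assoc] at this
  · rw [map_smul, d_cup ha.1, h₁]
    simp [smul_smul, ← mul_pow]

/-- The cochain map `f^# : C^*(X; R) → C^*(A; R)` induced by a continuous map `f : A → X`. -/
def pullback {A : Type u} [TopologicalSpace A] (f : C(A, X)) :
    Cochains R X →ₗ[R] Cochains R A where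
  toFun c n σ := c n (f.comp σ)
  map_add' _ _ := rfl
  map_smul' _ _ := rfl

lemma d_pullback {A : Type u} [TopologicalSpace A] (f : C(A, X)) (c : Cochains R X) :
    d (pullback f c) = pullback f (d c) := by
  funext n σ
  cases n with
  | zero => rfl
  | succ m => rfl

lemma pullback_mem_deg {A : Type u} [TopologicalSpace A] (f : C(A, X)) {k : ℤ}
    {c : Cochains R X} (hc : c ∈ deg R X k) : pullback f c ∈ deg R A k := by
  intro n hn
  funext σ
  exact congrFun (hc n hn) _

lemma pullback_mem_cocycles {A : Type u} [TopologicalSpace A] (f : C(A, X)) {k : ℤ}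
    {c : Cochains R X} (hc : c ∈ cocycles R X k) : pullback f c ∈ cocycles R A k := by
  refine ⟨pullback_mem_deg f hc.1, ?_⟩
  have h : d c = 0 := hc.2
  change d (pullback f c) = 0
  rw [d_pullback, h, map_zero]

lemma pullback_mem_coboundaries {A : Type u} [TopologicalSpace A] (f : C(A, X)) {k : ℤ}
    {c : Cochains R X} (hc : c ∈ coboundaries R X k) : pullback f c ∈ coboundaries R A k := by
  obtain ⟨e, he, rfl⟩ := hc
  exact ⟨pullback f e, pullback_mem_deg f he, d_pullback f e⟩

end Cochains

open Cochains

/-! ### Singular cohomology, cup products and Massey products -/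

/-- The singular cohomology `H^k(X; R)`; this is zero for `k < 0`. -/
abbrev Cohomology (R : Type v) [CommRing R] (X : Type u) [TopologicalSpace X] (k : ℤ) :
    Type (max u v) :=
  cocycles R X k ⧸ (coboundaries R X k).submoduleOf (cocycles R X k)

variable {R : Type v} [CommRing R] {X : Type u} [TopologicalSpace X]

/-- The cohomology class `[z]` of a cocycle `z`. -/
noncomputable abbrev Cohomology.mk {k : ℤ} (z : cocycles R X k) : Cohomology R X k :=
  Submodule.Quotient.mk z

/-- The induced map `f^* : H^k(X; R) → H^k(A; R)`. -/
noncomputable def Cohomology.map {A : Type u} [TopologicalSpace A] (f : C(A, X)) (k : ℤ) :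
    Cohomology R X k →ₗ[R] Cohomology R A k :=
  Submodule.mapQ _ _
    ((pullback f).restrict (p := cocycles R X k) (q := cocycles R A k)
      fun _ hc => pullback_mem_cocycles f hc)
    fun _ hc => pullback_mem_coboundaries f hc

lemma Cohomology.mk_eq_mk_iff {k : ℤ} (z w : cocycles R X k) :
    Cohomology.mk z = Cohomology.mk w ↔ z.1 - w.1 ∈ coboundaries R X k :=
  Submodule.Quotient.eq _

lemma Cohomology.mk_cup_eq {p q : ℕ} {a a' : cocycles R X p} {b b' : cocycles R X q}
    (ha : Cohomology.mk a = Cohomology.mk a') (hb : Cohomology.mk b = Cohomology.mk b') :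
    Cohomology.mk ⟨Cochains.cup a.1 b.1, cup_mem_cocycles a.2 b.2⟩ =
      Cohomology.mk ⟨Cochains.cup a'.1 b'.1, cup_mem_cocycles a'.2 b'.2⟩ := by
  rw [Cohomology.mk_eq_mk_iff] at ha hb ⊢
  have e : Cochains.cup a.1 b.1 - Cochains.cup a'.1 b'.1 =
      Cochains.cup (a.1 - a'.1) b.1 + Cochains.cup a'.1 (b.1 - b'.1) := by
    simp only [map_sub, LinearMap.sub_apply]
    abel
  change Cochains.cup a.1 b.1 - Cochains.cup a'.1 b'.1 ∈ _
  rw [e]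
  exact add_mem (cup_mem_coboundaries_left ha b.2) (cup_mem_coboundaries_right a'.2 hb)

/-- The cup product `H^p(X; R) × H^q(X; R) → H^{p+q}(X; R)`, `([a], [b]) ↦ [a • b]`. -/
noncomputable def Cohomology.cup {p q : ℕ} (α : Cohomology R X p) (β : Cohomology R X q) :
    Cohomology R X (p + q) :=
  Quotient.liftOn₂ α β
    (fun a b => Cohomology.mk ⟨Cochains.cup a.1 b.1, cup_mem_cocycles a.2 b.2⟩)
    fun _ _ _ _ ha hb => Cohomology.mk_cup_eq (Quotient.sound ha) (Quotient.sound hb)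

lemma Cohomology.cup_mk {p q : ℕ} (a : cocycles R X p) (b : cocycles R X q) :
    Cohomology.cup (Cohomology.mk a) (Cohomology.mk b) =
      Cohomology.mk ⟨Cochains.cup a.1 b.1, cup_mem_cocycles a.2 b.2⟩ := rfl

/-- The Massey product `⟨α, β, γ⟩` is defined: `αβ = 0 = βγ`. -/
def MasseyDefined {p q r : ℕ} (α : Cohomology R X p) (β : Cohomology R X q)
    (γ : Cohomology R X r) : Prop :=
  Cohomology.cup α β = 0 ∧ Cohomology.cup β γ = 0

/-- The Massey product `⟨α, β, γ⟩ ⊆ H^{p+q+r-1}(X; R)`: the set of all classes of cocycles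
`a • l + (-1)^{p+1} m • c`, where `a`, `b`, `c` are cocycles representing `α`, `β`, `γ`, and
`m`, `l` are cochains of degrees `p + q - 1`, `q + r - 1` with `dm = a • b` and `dl = b • c`. -/
def masseyProduct {p q r : ℕ} (α : Cohomology R X p) (β : Cohomology R X q)
    (γ : Cohomology R X r) : Set (Cohomology R X (p + q + r - 1)) :=
  {x | ∃ (a : cocycles R X p) (b : cocycles R X q) (c : cocycles R X r)
      (m l : Cochains R X) (z : cocycles R X (p + q + r - 1)),
    Cohomology.mk a = α ∧ Cohomology.mk b = β ∧ Cohomology.mk c = γ ∧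
    m ∈ deg R X (p + q - 1) ∧ l ∈ deg R X (q + r - 1) ∧
    d m = Cochains.cup a.1 b.1 ∧ d l = Cochains.cup b.1 c.1 ∧
    z.1 = Cochains.cup a.1 l + (-1 : R) ^ (p + 1) • Cochains.cup m c.1 ∧
    x = Cohomology.mk z}

/-! ### Fibrations, Schwarz genus and weight -/

/-- A (Hurewicz) fibration: a map with the homotopy lifting property for all spaces `Y`. -/
def IsFibration {E B : Type u} [TopologicalSpace E] [TopologicalSpace B] (p : C(E, B)) : Prop :=
  ∀ (Y : Type u) [TopologicalSpace Y] (H : C(Y × unitInterval, B)) (g : C(Y, E)),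
    (∀ y, p (g y) = H (y, 0)) →
      ∃ G : C(Y × unitInterval, E), (∀ y, G (y, 0) = g y) ∧ ∀ z, p (G z) = H z

/-- `B` is covered by `k` open subsets, on each of which `p` has a continuous local section. -/
def HasSectionalCover {E B : Type u} [TopologicalSpace E] [TopologicalSpace B] (p : C(E, B))
    (k : ℕ) : Prop :=
  ∃ U : Fin k → Set B, (∀ i, IsOpen (U i)) ∧ (⋃ i, U i) = Set.univ ∧
    ∀ i, ∃ s : C(U i, E), ∀ x : U i, p (s x) = x

/-- The Schwarz genus of `p`: the least `k` such that `B` is covered by `k` open subsets with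
local sections of `p`, and `∞` if there is no such `k`. -/
noncomputable def genus {E B : Type u} [TopologicalSpace E] [TopologicalSpace B] (p : C(E, B)) :
    ℕ∞ :=
  ⨅ (k : ℕ) (_ : HasSectionalCover p k), (k : ℕ∞)

/-- The pull-back `f^* p`, the projection onto `A` of `{(a, e) ∈ A × E | f a = p e}`. -/
def pullbackFibration {A E B : Type u} [TopologicalSpace A] [TopologicalSpace E]
    [TopologicalSpace B] (f : C(A, B)) (p : C(E, B)) : C(Function.Pullback f p, A) :=
  ⟨Function.Pullback.fst, continuous_fst.comp continuous_subtype_val⟩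

/-- The weight of a cohomology class `u ∈ H^n(B; R)` with respect to `p : E → B`: the supremum
of the `k` such that `f^* u = 0` for all spaces `A` and maps `f : A → B` with
`genus (f^* p) ≤ k`. (It is meant for `u ≠ 0`; it is `∞` for `u = 0`.) -/
noncomputable def wgt {E B : Type u} [TopologicalSpace E] [TopologicalSpace B] (p : C(E, B))
    {n : ℤ} (u : Cohomology R B n) : ℕ∞ :=
  ⨆ (k : ℕ) (_ : ∀ (A : Type u) [TopologicalSpace A] (f : C(A, B)),
    genus (pullbackFibration f p) ≤ k → Cohomology.map (R := R) f n u = 0), (k : ℕ∞)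

end MasseyGenus

open MasseyGenus

/-! Suppose the genus is at most the right-hand side, with both weights in it finite. Then `B = V ∪
W`, where `V` is a union of at most `wgt p β` open sets with local sections and `W` one of at most
`min (wgt p α) (wgt p γ)`. So `β` dies on `V` while `α` and `γ` die on `W`, and
`zero_mem_masseyProduct` puts `0` into the Massey product. There, cocycles `a`, `c` are chosen to
vanish on simplices in `W` and `b` to vanish on simplices in `V`, so `a • b` and `b • c` vanish on
every simplex lying in `V` or in `W`. By the small simplices theorem `exists_d_eq_of_vanishesOn`
they bound cochains `m`, `l` with the same property; the resulting Massey cocycle again has it,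
hence is a coboundary.

The small simplices theorem is proved on functions of tuples of points in a simplex. If `S` denotes
subdivision and `h` its homotopy to the identity, the cobounding cochain is the infinite sum of `S^m
(h z)`. The sum is finite on each simplex, because high subdivisions only see small tuples, where `h
z` vanishes.

Infinite weights are excluded by showing that a class of infinite weight is zero
(`eq_zero_of_wgt_eq_top`). The space `SectionSpace p (n + 1)` over `B` has genus at most `n + 1`,
and `H^n(B)` injects into its cohomology: simplices of dimension at most `n` lift to it compatibly
with faces. The `i`-th partial section is defined over the open stars of the barycentres of the
`i`-dimensional faces, by transport along straight lines from these barycentres. -/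

namespace MasseyGenus

open Cochains Topology

/-! ### Functions on tuples: coboundary, subdivision and the subdivision homotopy -/

section Tuple

variable {R : Type*} [CommRing R] {V V' : Type*}

/-- The alternating sum over the faces of a tuple, as an operator on functions of tuples. -/
def tupleD (R : Type*) [CommRing R] (V : Type*) (l : ℕ) :
    ((Fin l → V) → R) →ₗ[R] ((Fin (l + 1) → V) → R) :=
  ∑ k : Fin (l + 1), (-1 : R) ^ (k : ℕ) • LinearMap.funLeft R R (fun v => v ∘ k.succAbove)

lemma tupleD_apply {l : ℕ} (F : (Fin l → V) → R) (v : Fin (l + 1) → V) :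
    tupleD R V l F v = ∑ k : Fin (l + 1), (-1) ^ (k : ℕ) * F (v ∘ k.succAbove) := by
  simp [tupleD, LinearMap.funLeft_apply]

/-- The function `u ↦ F (x, u)`. -/
def coneAt (R : Type*) [CommRing R] {V : Type*} (l : ℕ) (x : V) :
    ((Fin (l + 1) → V) → R) →ₗ[R] ((Fin l → V) → R) :=
  LinearMap.funLeft R R (fun u => (Fin.cons x u : Fin (l + 1) → V))

lemma coneAt_apply {l : ℕ} (x : V) (F : (Fin (l + 1) → V) → R) (u : Fin l → V) :
    coneAt R l x F u = F (Fin.cons x u : Fin (l + 1) → V) := rfl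

lemma cons_comp_succAbove_zero {l : ℕ} (x : V) (u : Fin l → V) :
    (Fin.cons x u : Fin (l + 1) → V) ∘ (0 : Fin (l + 1)).succAbove = u := by
  funext t
  simp

lemma cons_comp_succAbove_succ {l : ℕ} (x : V) (u : Fin (l + 1) → V) (k : Fin (l + 1)) :
    (Fin.cons x u : Fin (l + 2) → V) ∘ k.succ.succAbove =
      (Fin.cons x (u ∘ k.succAbove) : Fin (l + 1) → V) := by
  funext t
  cases t using Fin.cases <;> simp [Fin.cons_succ]

/-- Dual to the boundary formula `∂(x, u) = u - (x, ∂u)` for cones. All later identities follow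
formally from this one, with the empty tuple as the augmented bottom degree. -/
lemma coneAt_tupleD {l : ℕ} (x : V) (F : (Fin (l + 1) → V) → R) :
    coneAt R (l + 1) x (tupleD R V (l + 1) F) = F - tupleD R V l (coneAt R l x F) := by
  funext u
  simp only [coneAt_apply, tupleD_apply, Pi.sub_apply]
  rw [Fin.sum_univ_succ]
  simp only [cons_comp_succAbove_succ, cons_comp_succAbove_zero, Fin.val_zero, pow_zero, one_mul,
    Fin.val_succ, pow_succ, mul_neg, mul_one, neg_mul, Finset.sum_neg_distrib, sub_eq_add_neg]

lemma coneAt_tupleD_zero (x : V) (F : (Fin 0 → V) → R) :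
    coneAt R 0 x (tupleD R V 0 F) = F := by
  funext u
  simp [coneAt_apply, tupleD_apply]

lemma tupleD_tupleD {l : ℕ} (F : (Fin l → V) → R) :
    tupleD R V (l + 1) (tupleD R V l F) = 0 := by
  funext v
  obtain ⟨x, u, rfl⟩ : ∃ (x : V) (u : Fin (l + 1) → V), v = Fin.cons x u :=
    ⟨v 0, Fin.tail v, (Fin.cons_self_tail v).symm⟩
  change coneAt R (l + 1) x (tupleD R V (l + 1) (tupleD R V l F)) u = 0
  rw [coneAt_tupleD]
  induction l generalizing x with
  | zero => rw [coneAt_tupleD_zero, sub_self, Pi.zero_apply]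
  | succ l ih =>
    obtain ⟨y, w, rfl⟩ : ∃ (y : V) (w : Fin (l + 1) → V), u = Fin.cons y w :=
      ⟨u 0, Fin.tail u, (Fin.cons_self_tail u).symm⟩
    -- Two uses of the cone formula replace `F` by its cone function, with one vertex fewer.
    rw [coneAt_tupleD, map_sub, sub_sub_cancel]
    change coneAt R (l + 1) y (tupleD R V (l + 1) (tupleD R V l (coneAt R l x F))) w = 0
    rw [coneAt_tupleD]
    exact ih _ _ _

variable (b : ∀ l : ℕ, (Fin (l + 1) → V) → V) (b' : ∀ l : ℕ, (Fin (l + 1) → V') → V')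

/-- Barycentric subdivision, acting on functions of tuples. -/
def subdiv (R : Type*) [CommRing R] {V : Type*} (b : ∀ l : ℕ, (Fin (l + 1) → V) → V) :
    ∀ l : ℕ, ((Fin l → V) → R) →ₗ[R] ((Fin l → V) → R)
  | 0 => LinearMap.id
  | l + 1 => LinearMap.pi fun v => ∑ k : Fin (l + 1), (-1 : R) ^ (k : ℕ) •
      (LinearMap.proj (v ∘ k.succAbove) ∘ₗ subdiv R b l ∘ₗ coneAt R l (b l v))

lemma subdiv_zero (F : (Fin 0 → V) → R) : subdiv R b 0 F = F := rfl

lemma subdiv_succ {l : ℕ} (F : (Fin (l + 1) → V) → R) (v : Fin (l + 1) → V) :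
    subdiv R b (l + 1) F v = tupleD R V l (subdiv R b l (coneAt R l (b l v) F)) v := by
  simp [subdiv, tupleD_apply]

/-- The homotopy between barycentric subdivision and the identity, acting on functions of
tuples. -/
def subdivHomotopy (R : Type*) [CommRing R] {V : Type*} (b : ∀ l : ℕ, (Fin (l + 1) → V) → V) :
    ∀ l : ℕ, ((Fin (l + 1) → V) → R) →ₗ[R] ((Fin l → V) → R)
  | 0 => 0
  | l + 1 => LinearMap.pi fun v => LinearMap.proj v ∘ₗ coneAt R (l + 1) (b l v) -
      ∑ k : Fin (l + 1), (-1 : R) ^ (k : ℕ) •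
        (LinearMap.proj (v ∘ k.succAbove) ∘ₗ subdivHomotopy R b l ∘ₗ coneAt R (l + 1) (b l v))

lemma subdivHomotopy_zero (F : (Fin 1 → V) → R) : subdivHomotopy R b 0 F = 0 := rfl

lemma subdivHomotopy_succ {l : ℕ} (F : (Fin (l + 2) → V) → R) (v : Fin (l + 1) → V) :
    subdivHomotopy R b (l + 1) F v = F (Fin.cons (b l v) v : Fin (l + 2) → V) -
      tupleD R V l (subdivHomotopy R b l (coneAt R (l + 1) (b l v) F)) v := by
  simp [subdivHomotopy, tupleD_apply, coneAt_apply]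

/-- Subdivision is dual to coning the subdivided boundary from the barycentre; the cone formula
leaves the desired term and one killed by the square of `tupleD`. -/
lemma subdiv_tupleD {l : ℕ} (F : (Fin l → V) → R) :
    subdiv R b (l + 1) (tupleD R V l F) = tupleD R V l (subdiv R b l F) := by
  funext v
  induction l with
  | zero => rw [subdiv_succ, coneAt_tupleD_zero]
  | succ l ih =>
    have ih' : ∀ G : (Fin l → V) → R,
        subdiv R b (l + 1) (tupleD R V l G) = tupleD R V l (subdiv R b l G) :=
      fun G => funext (ih G)
    rw [subdiv_succ, coneAt_tupleD, map_sub, map_sub, ih', tupleD_tupleD, sub_zero]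

/-- The homotopy is dual to `v ↦ b · (v - T ∂v)`, with `b` the barycentre and `T` the homotopy one
dimension lower. The identity in one degree needs the preceding one only after applying `tupleD`,
which is the hypothesis of `base`. -/
lemma subdivHomotopy_tupleD {l : ℕ} (F : (Fin (l + 1) → V) → R) :
    subdivHomotopy R b (l + 1) (tupleD R V (l + 1) F) + tupleD R V l (subdivHomotopy R b l F) =
      F - subdiv R b (l + 1) F := by
  have base : ∀ (l : ℕ) (F : (Fin (l + 1) → V) → R) (v : Fin (l + 1) → V),
      (∀ G : (Fin l → V) → R, tupleD R V l (subdivHomotopy R b l (tupleD R V l G)) =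
        tupleD R V l G - tupleD R V l (subdiv R b l G)) →
      subdivHomotopy R b (l + 1) (tupleD R V (l + 1) F) v +
        tupleD R V l (subdivHomotopy R b l F) v = F v - subdiv R b (l + 1) F v := by
    intro l F v h
    rw [subdivHomotopy_succ, coneAt_tupleD, show tupleD R V (l + 1) F (Fin.cons (b l v) v) =
      (F - tupleD R V l (coneAt R l (b l v) F)) v from congrFun (coneAt_tupleD _ F) v,
      map_sub, map_sub, h, subdiv_succ]
    simp only [Pi.sub_apply]
    ring
  induction l with
  | zero =>
    funext v
    exact base 0 F v fun G => by simp [subdivHomotopy_zero, subdiv_zero]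
  | succ l ih =>
    funext v
    refine base (l + 1) F v fun G => ?_
    rw [← map_sub, ← ih G, map_add, tupleD_tupleD, add_zero]

/-- The homotopy between the `M`-fold subdivision and the identity. -/
def iterHomotopy (R : Type*) [CommRing R] {V : Type*} (b : ∀ l : ℕ, (Fin (l + 1) → V) → V)
    (M l : ℕ) : ((Fin (l + 1) → V) → R) →ₗ[R] ((Fin l → V) → R) :=
  ∑ i ∈ Finset.range M, (subdiv R b l ^ i) ∘ₗ subdivHomotopy R b l

lemma subdiv_pow_tupleD {l : ℕ} (i : ℕ) (F : (Fin l → V) → R) :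
    (subdiv R b (l + 1) ^ i) (tupleD R V l F) = tupleD R V l ((subdiv R b l ^ i) F) := by
  induction i generalizing F with
  | zero => rfl
  | succ i ih => rw [pow_succ, pow_succ, Module.End.mul_apply, Module.End.mul_apply,
      subdiv_tupleD, ih]

/-- A telescoping sum: each power of subdivision commutes with `tupleD`. -/
lemma iterHomotopy_tupleD {l : ℕ} (M : ℕ) (F : (Fin (l + 1) → V) → R) :
    iterHomotopy R b M (l + 1) (tupleD R V (l + 1) F) + tupleD R V l (iterHomotopy R b M l F) =
      F - (subdiv R b (l + 1) ^ M) F := by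
  induction M with
  | zero => simp [iterHomotopy]
  | succ M ih =>
    have h := congrArg (subdiv R b (l + 1) ^ M) (subdivHomotopy_tupleD b F)
    rw [map_add, map_sub, subdiv_pow_tupleD, ← Module.End.mul_apply _ (subdiv R b (l + 1)),
      ← pow_succ] at h
    simp only [iterHomotopy, Finset.sum_range_succ, LinearMap.add_apply, map_add] at ih ⊢
    rw [add_add_add_comm, ih, LinearMap.comp_apply, LinearMap.comp_apply, h]
    abel

lemma comp_cons {l : ℕ} (g : V → V') (x : V) (u : Fin l → V) :
    g ∘ (Fin.cons x u : Fin (l + 1) → V) = (Fin.cons (g x) (g ∘ u) : Fin (l + 1) → V') := by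
  funext t
  cases t using Fin.cases <;> simp

-- Naturality under maps preserving barycentres; needed for face inclusions, so that the operators
-- are compatible with the faces of a singular simplex.
variable {b b'} in
lemma subdiv_comp {g : V → V'} (hg : ∀ (l : ℕ) (v : Fin (l + 1) → V), b' l (g ∘ v) = g (b l v))
    {l : ℕ} (F : (Fin l → V') → R) (v : Fin l → V) :
    subdiv R b' l F (g ∘ v) = subdiv R b l (fun w => F (g ∘ w)) v := by
  induction l with
  | zero => rfl
  | succ l ih =>
    rw [subdiv_succ, subdiv_succ, tupleD_apply, tupleD_apply]
    refine Finset.sum_congr rfl fun k _ => ?_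
    rw [Function.comp_assoc, ih, hg]
    refine congrArg _ (congrFun (congrArg _ (funext fun u => ?_)) _)
    rw [coneAt_apply, coneAt_apply, comp_cons]

variable {b b'} in
lemma subdivHomotopy_comp {g : V → V'}
    (hg : ∀ (l : ℕ) (v : Fin (l + 1) → V), b' l (g ∘ v) = g (b l v))
    {l : ℕ} (F : (Fin (l + 1) → V') → R) (v : Fin l → V) :
    subdivHomotopy R b' l F (g ∘ v) = subdivHomotopy R b l (fun w => F (g ∘ w)) v := by
  induction l with
  | zero => rfl
  | succ l ih =>
    rw [subdivHomotopy_succ, subdivHomotopy_succ, tupleD_apply, tupleD_apply, hg, comp_cons]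
    congr 1
    refine Finset.sum_congr rfl fun k _ => ?_
    rw [Function.comp_assoc, ih]
    refine congrArg _ (congrFun (congrArg _ (funext fun u => ?_)) _)
    rw [coneAt_apply, coneAt_apply, comp_cons]

variable {b b'} in
lemma subdiv_pow_comp {g : V → V'}
    (hg : ∀ (l : ℕ) (v : Fin (l + 1) → V), b' l (g ∘ v) = g (b l v))
    {l : ℕ} (i : ℕ) (F : (Fin l → V') → R) (v : Fin l → V) :
    (subdiv R b' l ^ i) F (g ∘ v) = (subdiv R b l ^ i) (fun w => F (g ∘ w)) v := by
  induction i generalizing F with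
  | zero => rfl
  | succ i ih =>
    rw [pow_succ, pow_succ, Module.End.mul_apply, Module.End.mul_apply, ih]
    exact congrFun (congrArg _ (funext fun w => subdiv_comp hg F w)) _

lemma iterHomotopy_apply (M : ℕ) {l : ℕ} (F : (Fin (l + 1) → V) → R) (v : Fin l → V) :
    iterHomotopy R b M l F v =
      ∑ i ∈ Finset.range M, (subdiv R b l ^ i) (subdivHomotopy R b l F) v := by
  simp [iterHomotopy]

variable {b b'} in
lemma iterHomotopy_comp {g : V → V'}
    (hg : ∀ (l : ℕ) (v : Fin (l + 1) → V), b' l (g ∘ v) = g (b l v))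
    (M : ℕ) {l : ℕ} (F : (Fin (l + 1) → V') → R) (v : Fin l → V) :
    iterHomotopy R b' M l F (g ∘ v) = iterHomotopy R b M l (fun w => F (g ∘ w)) v := by
  rw [iterHomotopy_apply, iterHomotopy_apply]
  refine Finset.sum_congr rfl fun i _ => ?_
  rw [subdiv_pow_comp hg]
  exact congrFun (congrArg _ (funext fun w => subdivHomotopy_comp hg F w)) _

/-- A set containing the barycentres of its tuples. -/
def BaryClosed (b : ∀ l : ℕ, (Fin (l + 1) → V) → V) (C : Set V) : Prop :=
  ∀ (l : ℕ) (v : Fin (l + 1) → V), (∀ i, v i ∈ C) → b l v ∈ C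

-- The homotopy only evaluates on tuples built from the vertices and iterated barycentres, which
-- stay in `C`. Thus vanishing on small tuples passes from `F` to its homotopy.
variable {b} in
lemma subdivHomotopy_eq_zero {C : Set V} (hC : BaryClosed b C) {l : ℕ}
    (F : (Fin (l + 1) → V) → R) (hF : ∀ u, (∀ i, u i ∈ C) → F u = 0) (v : Fin l → V)
    (hv : ∀ i, v i ∈ C) : subdivHomotopy R b l F v = 0 := by
  induction l with
  | zero => rfl
  | succ l ih =>
    have hcons : ∀ {m : ℕ} (u : Fin m → V), (∀ i, u i ∈ C) →
        ∀ i, (Fin.cons (b l v) u : Fin (m + 1) → V) i ∈ C := fun u hu i => by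
      cases i using Fin.cases with
      | zero => exact hC l v hv
      | succ i => exact hu i
    rw [subdivHomotopy_succ, hF _ (hcons v hv), tupleD_apply, zero_sub, neg_eq_zero]
    refine Finset.sum_eq_zero fun k _ => ?_
    rw [ih (coneAt R (l + 1) (b l v) F) (fun u hu => hF _ (hcons u hu)) (v ∘ k.succAbove)
      fun i => hv _, mul_zero]

/-! ### Shrinking of tuples under subdivision. -/

section Metric

variable {b} {W : Type*} [PseudoMetricSpace W] {c : ∀ l : ℕ, (Fin (l + 1) → W) → W}
  {N : ℕ} {ρ : ℝ}

/-- Subdivision shrinks the diameter by the factor `ρ`. -/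
lemma subdiv_eq_zero (hball : ∀ x r, BaryClosed c (Metric.closedBall x r)) (hρ : 0 ≤ ρ)
    (hc : ∀ l < N, ∀ (v : Fin (l + 1) → W) (δ : ℝ), (∀ i j, dist (v i) (v j) ≤ δ) →
      ∀ j, dist (v j) (c l v) ≤ ρ * δ)
    {C : Set W} (hC : BaryClosed c C) {l : ℕ} (hl : l ≤ N) (F : (Fin l → W) → R) (δ : ℝ)
    (hF : ∀ u, (∀ i, u i ∈ C) → (∀ i j, dist (u i) (u j) ≤ ρ * δ) → F u = 0)
    (v : Fin l → W) (hv : ∀ i, v i ∈ C) (hd : ∀ i j, dist (v i) (v j) ≤ δ) :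
    subdiv R c l F v = 0 := by
  induction l generalizing C with
  | zero => exact hF v hv fun i => i.elim0
  | succ l ih =>
    have hδ : 0 ≤ ρ * δ := mul_nonneg hρ (dist_nonneg.trans (hd 0 0))
    rw [subdiv_succ, tupleD_apply]
    refine Finset.sum_eq_zero fun k _ => ?_
    -- Shrinking `C` to this ball makes the induction carry the distance from the cone point `c l v`
    -- to all remaining vertices.
    have hC' : BaryClosed c (C ∩ Metric.closedBall (c l v) (ρ * δ)) := fun m w hw =>
      ⟨hC m w fun i => (hw i).1, hball _ _ m w fun i => (hw i).2⟩
    rw [ih hC' (by omega) _ ?_ (v ∘ k.succAbove) ?_ fun i j => hd _ _, mul_zero]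
    · intro u hu hdu
      refine hF _ (fun i => ?_) (fun i j => ?_)
      · cases i using Fin.cases with
        | zero => exact hC l v hv
        | succ i => exact (hu i).1
      · cases i using Fin.cases with
        | zero =>
          cases j using Fin.cases with
          | zero => simpa using hδ
          | succ j =>
            rw [dist_comm]
            exact (hu j).2
        | succ i =>
          cases j using Fin.cases with
          | zero => exact (hu i).2
          | succ j => exact hdu i j
    · exact fun i => ⟨hv _, hc l (by omega) v δ hd _⟩

lemma subdiv_pow_eq_zero (hball : ∀ x r, BaryClosed c (Metric.closedBall x r)) (hρ : 0 ≤ ρ)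
    (hc : ∀ l < N, ∀ (v : Fin (l + 1) → W) (δ : ℝ), (∀ i j, dist (v i) (v j) ≤ δ) →
      ∀ j, dist (v j) (c l v) ≤ ρ * δ)
    {C : Set W} (hC : BaryClosed c C) {l : ℕ} (hl : l ≤ N) (M : ℕ) (F : (Fin l → W) → R) (δ : ℝ)
    (hF : ∀ u, (∀ i, u i ∈ C) → (∀ i j, dist (u i) (u j) ≤ ρ ^ M * δ) → F u = 0)
    (v : Fin l → W) (hv : ∀ i, v i ∈ C) (hd : ∀ i j, dist (v i) (v j) ≤ δ) :
    (subdiv R c l ^ M) F v = 0 := by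
  induction M generalizing δ v with
  | zero => exact hF v hv (by simpa using hd)
  | succ M ih =>
    rw [pow_succ', Module.End.mul_apply]
    refine subdiv_eq_zero hball hρ hc hC hl _ δ (fun u hu hdu => ?_) v hv hd
    refine ih (ρ * δ) (fun w hw hdw => hF w hw fun i j => ?_) u hu hdu
    rw [pow_succ, mul_assoc]
    exact hdw i j

end Metric

end Tuple

/-! ### Affine simplices and small simplices -/

/-- The affine map of standard simplices sending the vertices to the given points. -/
noncomputable def affineSimplex {m n : ℕ} (v : Fin (m + 1) → stdSimplex ℝ (Fin (n + 1))) :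
    C(stdSimplex ℝ (Fin (m + 1)), stdSimplex ℝ (Fin (n + 1))) where
  toFun x := ⟨∑ i, x i • (v i).1, (convex_stdSimplex ℝ _).sum_mem (fun i _ => x.2.1 i) x.2.2
    fun i _ => (v i).2⟩
  continuous_toFun := by
    refine Continuous.subtype_mk (continuous_finsetSum _ fun i _ => ?_) _
    exact ((continuous_apply i).comp continuous_subtype_val).smul continuous_const

lemma affineSimplex_coe {m n : ℕ} (v : Fin (m + 1) → stdSimplex ℝ (Fin (n + 1)))
    (x : stdSimplex ℝ (Fin (m + 1))) :
    (affineSimplex v x : Fin (n + 1) → ℝ) = ∑ i, x i • (v i : Fin (n + 1) → ℝ) := rfl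

lemma simplexMap_apply {m n : ℕ} (f : Fin (m + 1) → Fin (n + 1))
    (x : stdSimplex ℝ (Fin (m + 1))) (t : Fin (n + 1)) :
    simplexMap f x t = ∑ i with f i = t, x i := by
  change FunOnFinite.linearMap ℝ ℝ f x t = _
  rw [FunOnFinite.linearMap_apply_apply]

lemma affineSimplex_comp_simplexMap {l m n : ℕ} (v : Fin (m + 1) → stdSimplex ℝ (Fin (n + 1)))
    (f : Fin (l + 1) → Fin (m + 1)) :
    (affineSimplex v).comp (simplexMap f) = affineSimplex (v ∘ f) := by
  ext x : 2
  rw [ContinuousMap.comp_apply, affineSimplex_coe, affineSimplex_coe]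
  simp only [simplexMap_apply, Finset.sum_smul]
  rw [← Finset.sum_fiberwise Finset.univ f fun i => x i • ((v ∘ f) i : Fin (n + 1) → ℝ)]
  refine Finset.sum_congr rfl fun j _ => Finset.sum_congr rfl fun i hi => ?_
  rw [Finset.mem_filter] at hi
  simp [← hi.2]

lemma simplexMap_affineSimplex {l m n : ℕ} (v : Fin (l + 1) → stdSimplex ℝ (Fin (m + 1)))
    (f : Fin (m + 1) → Fin (n + 1)) (x : stdSimplex ℝ (Fin (l + 1))) :
    simplexMap f (affineSimplex v x) = affineSimplex (simplexMap f ∘ v) x := by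
  ext : 1
  change FunOnFinite.linearMap ℝ ℝ f (∑ i, x i • (v i : Fin (m + 1) → ℝ)) = _
  rw [map_sum]
  simp only [map_smul]
  rfl

lemma affineSimplex_vertex {m n : ℕ} (f : Fin (m + 1) → Fin (n + 1)) :
    affineSimplex (fun i => stdSimplex.vertex (f i)) = simplexMap f := by
  ext x t
  rw [affineSimplex_coe, simplexMap_apply, Finset.sum_apply, Finset.sum_filter]
  refine Finset.sum_congr rfl fun i _ => ?_
  simp [Pi.single_apply, eq_comm]

lemma simplexMap_id (n : ℕ) : simplexMap (id : Fin (n + 1) → Fin (n + 1)) =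
    ContinuousMap.id _ := by
  ext x : 1
  exact stdSimplex.map_id_apply x

/-- The barycentre of a tuple of points of a standard simplex. -/
noncomputable def tupleBary (n : ℕ) (l : ℕ) (v : Fin (l + 1) → stdSimplex ℝ (Fin (n + 1))) :
    stdSimplex ℝ (Fin (n + 1)) :=
  affineSimplex v stdSimplex.barycenter

/-- Affine maps preserve barycentres; this supplies the hypothesis `hg` of the naturality lemmas. -/
lemma tupleBary_simplexMap {m n : ℕ} (f : Fin (m + 1) → Fin (n + 1)) (l : ℕ)
    (v : Fin (l + 1) → stdSimplex ℝ (Fin (m + 1))) :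
    tupleBary n l (simplexMap f ∘ v) = simplexMap f (tupleBary m l v) :=
  (simplexMap_affineSimplex v f _).symm

lemma affineSimplex_mem_closedBall {m n : ℕ} {y : stdSimplex ℝ (Fin (n + 1))} {r : ℝ}
    (v : Fin (m + 1) → stdSimplex ℝ (Fin (n + 1))) (hv : ∀ i, v i ∈ Metric.closedBall y r)
    (x : stdSimplex ℝ (Fin (m + 1))) : affineSimplex v x ∈ Metric.closedBall y r := by
  have : (affineSimplex v x).1 ∈ Metric.closedBall y.1 r :=
    (convex_closedBall y.1 r).sum_mem (fun i _ => x.2.1 i) x.2.2 fun i _ => hv i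
  exact this

/-- Balls are convex. This is why smallness of tuples is later expressed by containment in a closed
ball inside a member of the cover. -/
lemma baryClosed_closedBall {n : ℕ} (y : stdSimplex ℝ (Fin (n + 1))) (r : ℝ) :
    BaryClosed (tupleBary n) (Metric.closedBall y r) :=
  fun _ v hv => affineSimplex_mem_closedBall v hv _

/-- The difference `v j - b` from the barycentre `b` is the sum of the `l` vectors `v j - v i`, `i ≠
j`, divided by `l + 1`; and `l / (l + 1)` increases with `l`. -/
lemma dist_tupleBary_le {n N l : ℕ} (hl : l < N + 1) (v : Fin (l + 1) → stdSimplex ℝ (Fin (n + 1)))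
    (δ : ℝ) (hd : ∀ i j, dist (v i) (v j) ≤ δ) (j : Fin (l + 1)) :
    dist (v j) (tupleBary n l v) ≤ (N / (N + 1) : ℝ) * δ := by
  have hδ : 0 ≤ δ := dist_nonneg.trans (hd 0 0)
  have hpos : (0 : ℝ) < l + 1 := by positivity
  have e : (v j).1 - (tupleBary n l v).1 =
      ((l : ℝ) + 1)⁻¹ • ∑ i ∈ Finset.univ.erase j, ((v j).1 - (v i).1) := by
    have h₁ : (tupleBary n l v).1 = ((l : ℝ) + 1)⁻¹ • ∑ i, (v i).1 := by
      rw [Finset.smul_sum]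
      change ∑ i, (stdSimplex.barycenter : stdSimplex ℝ (Fin (l + 1))) i • (v i).1 = _
      refine Finset.sum_congr rfl fun i _ => ?_
      congr 1
      change ((Fintype.card (Fin (l + 1)) : ℝ))⁻¹ = _
      simp
    have h₂ : ∑ i ∈ Finset.univ.erase j, ((v j).1 - (v i).1) = ∑ i, ((v j).1 - (v i).1) :=
      Finset.sum_erase (f := fun i => (v j).1 - (v i).1) _ (sub_self (v j).1)
    rw [h₁, h₂, Finset.sum_sub_distrib, smul_sub]
    congr 1
    rw [Finset.sum_const, Finset.card_univ, Fintype.card_fin, ← Nat.cast_smul_eq_nsmul ℝ,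
      smul_smul]
    push_cast
    rw [inv_mul_cancel₀ hpos.ne', one_smul]
  have hsum : ‖∑ i ∈ Finset.univ.erase j, ((v j).1 - (v i).1)‖ ≤ l * δ := by
    refine (norm_sum_le_of_le (f := fun i => (v j).1 - (v i).1) (n := fun _ => δ) _
      fun i _ => ?_).trans_eq ?_
    · rw [← dist_eq_norm]
      exact hd j i
    · simp
  have : dist (v j) (tupleBary n l v) ≤ ((l : ℝ) + 1)⁻¹ * (l * δ) := by
    rw [Subtype.dist_eq, dist_eq_norm, e, norm_smul, Real.norm_of_nonneg (by positivity)]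
    gcongr
  refine this.trans ?_
  rw [← mul_assoc]
  gcongr
  rw [inv_mul_eq_div, div_le_div_iff₀ hpos (by positivity)]
  have : (l : ℝ) ≤ N := by exact_mod_cast Nat.lt_succ_iff.mp hl
  nlinarith

/-- High subdivisions are supported on small tuples. -/
lemma exists_subdiv_pow_eq_zero {R : Type*} [CommRing R] {n : ℕ} {ι : Type*}
    (U : ι → Set (stdSimplex ℝ (Fin (n + 1)))) (hU : ∀ i, IsOpen (U i)) (hcov : ⋃ i, U i = Set.univ)
    (l : ℕ) : ∃ M, ∀ m ≥ M, ∀ F : (Fin (l + 1) → stdSimplex ℝ (Fin (n + 1))) → R,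
      (∀ u y r i, Metric.closedBall y r ⊆ U i → (∀ j, u j ∈ Metric.closedBall y r) → F u = 0) →
      ∀ v, (subdiv R (tupleBary n) (l + 1) ^ m) F v = 0 := by
  obtain ⟨δ, hδ, hball⟩ := lebesgue_number_lemma_of_metric (isCompact_univ) hU hcov.ge
  have hρ : (l / (l + 1) : ℝ) < 1 := by
    rw [div_lt_one (by positivity)]
    linarith
  obtain ⟨M, hM⟩ := exists_pow_lt_of_lt_one (half_pos hδ) hρ
  refine ⟨M, fun m hm F hF v => ?_⟩
  have hρ0 : (0 : ℝ) ≤ l / (l + 1) := by positivity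
  -- The starting diameter `1` bounds the diameter of the standard simplex in the sup metric.
  refine subdiv_pow_eq_zero (N := l + 1) baryClosed_closedBall hρ0
    (fun k hk w ε hw j => dist_tupleBary_le hk w ε hw j) (C := Set.univ)
    (fun _ _ _ => Set.mem_univ _) le_rfl m F 1 (fun u _ hu => ?_) v (fun _ => Set.mem_univ _)
    fun i j => ?_
  · obtain ⟨i, hi⟩ := hball (u 0) (Set.mem_univ _)
    refine hF u (u 0) (δ / 2) i ((Metric.closedBall_subset_ball (half_lt_self hδ)).trans hi)
      fun j => (hu j 0).trans ?_
    rw [mul_one]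
    exact (pow_le_pow_of_le_one hρ0 hρ.le hm).trans hM.le
  · rw [Subtype.dist_eq]
    exact (Metric.dist_le_diam_of_mem (bounded_stdSimplex _) (v i).2 (v j).2).trans
      diam_stdSimplex_le

/-! ### The small simplices theorem for cochains. -/

section SmallSimplices

variable {R : Type v} {X : Type u} [TopologicalSpace X]

/-- A cochain as a function of the affine simplices in a given singular simplex. -/
noncomputable def tupleEval (c : Cochains R X) {n : ℕ} (σ : SingularSimplex X n) (l : ℕ)
    (v : Fin (l + 1) → stdSimplex ℝ (Fin (n + 1))) : R :=
  c l (σ.comp (affineSimplex v))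

lemma tupleEval_simplexMap (c : Cochains R X) {m n : ℕ} (σ : SingularSimplex X n)
    (f : Fin (m + 1) → Fin (n + 1)) (l : ℕ) (v : Fin (l + 1) → stdSimplex ℝ (Fin (m + 1))) :
    tupleEval c (σ.comp (simplexMap f)) l v = tupleEval c σ l (simplexMap f ∘ v) := by
  rw [tupleEval, tupleEval, ContinuousMap.comp_assoc]
  congr 2
  ext x : 1
  exact simplexMap_affineSimplex v f x

variable [CommRing R]

/-- The cochain `c` vanishes on the simplices lying in `U`. -/
def VanishesOn (c : Cochains R X) (U : Set X) : Prop :=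
  ∀ (n : ℕ) (σ : SingularSimplex X n), (∀ x, σ x ∈ U) → c n σ = 0

/-- Faces of affine simplices are affine simplices, so tuple identities become cochain identities.
-/
lemma tupleD_tupleEval (c : Cochains R X) {n : ℕ} (σ : SingularSimplex X n) (l : ℕ) :
    tupleD R _ (l + 1) (tupleEval c σ l) = tupleEval (d c) σ (l + 1) := by
  funext v
  rw [tupleD_apply, tupleEval, d_succ]
  refine Finset.sum_congr rfl fun k _ => ?_
  rw [tupleEval, ContinuousMap.comp_assoc, affineSimplex_comp_simplexMap]

/-- The cohomological small simplices theorem: a cocycle vanishing on the simplices that are small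
with respect to an open cover is the coboundary of a cochain with the same property. -/
theorem exists_d_eq_of_vanishesOn {ι : Type*} (U : ι → Set X) (hU : ∀ i, IsOpen (U i))
    (hcov : ⋃ i, U i = Set.univ) {k : ℤ} {z : Cochains R X} (hz : z ∈ cocycles R X k)
    (hzU : ∀ i, VanishesOn z (U i)) :
    ∃ w ∈ deg R X (k - 1), d w = z ∧ ∀ i, VanishesOn w (U i) := by
  have hdz : d z = 0 := hz.2
  -- The `m`-th term of the series `∑ S^m (h z)`, evaluated at the vertices of `τ`.
  let T (n : ℕ) (τ : SingularSimplex X n) (m : ℕ) : R :=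
    (subdiv R (tupleBary n) (n + 1) ^ m)
      (subdivHomotopy R (tupleBary n) (n + 1) (tupleEval z τ (n + 1))) stdSimplex.vertex
  have hsmall : ∀ {n l : ℕ} (τ : SingularSimplex X n)
      (u : Fin (l + 1) → stdSimplex ℝ (Fin (n + 1))) y r i,
      Metric.closedBall y r ⊆ τ ⁻¹' U i → (∀ j, u j ∈ Metric.closedBall y r) →
      tupleEval z τ l u = 0 := fun τ u y r i hr hu =>
    hzU i _ _ fun x => hr (affineSimplex_mem_closedBall u hu x)
  have hUτ : ∀ {n : ℕ} (τ : SingularSimplex X n), (∀ i, IsOpen (τ ⁻¹' U i)) ∧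
      ⋃ i, τ ⁻¹' U i = Set.univ := fun τ =>
    ⟨fun i => (hU i).preimage τ.continuous, by rw [← Set.preimage_iUnion, hcov, Set.preimage_univ]⟩
  have hT : ∀ (n : ℕ) (τ : SingularSimplex X n), ∃ M, ∀ m ≥ M, T n τ m = 0 := by
    intro n τ
    obtain ⟨M, hM⟩ := exists_subdiv_pow_eq_zero (R := R) _ (hUτ τ).1 (hUτ τ).2 n
    exact ⟨M, fun m hm => hM m hm _ (fun u y r i hr hu => subdivHomotopy_eq_zero
      (baryClosed_closedBall y r) _ (fun u' hu' => hsmall τ u' y r i hr hu') u hu) _⟩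
  choose M hM using hT
  -- The cutoff `M n τ` depends on the simplex, but any larger one gives the same value (`hw`).
  -- Hence `w` behaves like the full series.
  let w : Cochains R X := fun n τ => ∑ m ∈ Finset.range (M n τ), T n τ m
  have hw : ∀ n τ N, M n τ ≤ N →
      w n τ = iterHomotopy R (tupleBary n) N (n + 1) (tupleEval z τ (n + 1)) stdSimplex.vertex := by
    intro n τ N hN
    rw [iterHomotopy_apply]
    refine Finset.sum_subset (Finset.range_subset_range.mpr hN) fun m _ hm => hM n τ m ?_
    simpa using hm
  have hT0 : ∀ n τ, tupleEval z τ (n + 1) = 0 → w n τ = 0 := by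
    intro n τ h
    rw [hw n τ _ le_rfl, h, map_zero]
    rfl
  refine ⟨w, fun n hn => funext fun τ => hT0 n τ ?_, ?_, fun i n τ hτ => hT0 n τ ?_⟩
  · funext v
    exact congrFun (hz.1 (n + 1) (by push_cast; omega)) _
  · funext n σ
    cases n with
    | zero =>
      -- A `0`-simplex lies in some `U i`, so `z` vanishes in degree `0`, as `d w` does.
      obtain ⟨i, hi⟩ := Set.mem_iUnion.mp (hcov.ge (Set.mem_univ (σ default)))
      rw [d_zero]
      refine (hzU i 0 σ fun x => ?_).symm
      rwa [Subsingleton.elim x default]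
    | succ n =>
      obtain ⟨M₁, hM₁⟩ := exists_subdiv_pow_eq_zero (R := R) _ (hUτ σ).1 (hUτ σ).2 (n + 1)
      -- One cutoff that serves all faces of `σ` and also kills the `N`-fold subdivision of `z` on
      -- `σ`.
      let N := M₁ + ∑ k : Fin (n + 2), M n (σ.comp (simplexMap k.succAbove))
      have hN : ∀ k : Fin (n + 2), M n (σ.comp (simplexMap k.succAbove)) ≤ N := fun k =>
        (Finset.single_le_sum (f := fun k : Fin (n + 2) => M n (σ.comp (simplexMap k.succAbove)))
          (fun _ _ => Nat.zero_le _) (Finset.mem_univ k)).trans (Nat.le_add_left _ _)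
      have key := congrFun (iterHomotopy_tupleD (tupleBary (n + 1)) N (tupleEval z σ (n + 1)))
        stdSimplex.vertex
      rw [tupleD_tupleEval, hdz, show tupleEval (0 : Cochains R X) σ (n + 1 + 1) = 0 from rfl,
        map_zero, zero_add, Pi.sub_apply, hM₁ N (Nat.le_add_right _ _) _
          (fun u y r i hr hu => hsmall σ u y r i hr hu), sub_zero, tupleD_apply] at key
      rw [d_succ]
      refine Eq.trans (Finset.sum_congr rfl fun k _ => ?_) (key.trans ?_)
      · rw [hw n _ N (hN k)]
        congr 1
        have e : (stdSimplex.vertex ∘ k.succAbove : Fin (n + 1) → stdSimplex ℝ (Fin (n + 2))) =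
            simplexMap k.succAbove ∘ stdSimplex.vertex := by
          funext i
          exact (stdSimplex.map_vertex (S := ℝ) k.succAbove i).symm
        rw [e, iterHomotopy_comp (tupleBary_simplexMap k.succAbove)]
        refine congrFun (congrArg _ (funext fun u => ?_)) _
        exact tupleEval_simplexMap z σ k.succAbove (n + 1) u
      · rw [tupleEval]
        congr 1
        have := affineSimplex_vertex (id : Fin (n + 2) → Fin (n + 2))
        rw [simplexMap_id] at this
        exact (congrArg _ this).trans (ContinuousMap.comp_id σ)
  · funext v
    exact hzU i _ _ fun x => hτ _

end SmallSimplices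

/-! ### Further properties of cochains -/

section CochainAlgebra

variable {R : Type v} [CommRing R] {X : Type u} [TopologicalSpace X]

lemma d_d (c : Cochains R X) : d (d c) = 0 := by
  funext n σ
  match n with
  | 0 => rfl
  | 1 => simp [d_succ, d_zero]
  | n + 2 =>
    -- The tuple identity on the vertex set of the simplex, evaluated at the identity tuple.
    have h := congrFun (tupleD_tupleD (R := R) (V := Fin (n + 3))
      (fun w : Fin (n + 1) → Fin (n + 3) => c n (σ.comp (simplexMap w)))) id
    simp only [tupleD_apply] at h
    simp only [d_succ, ContinuousMap.comp_assoc, simplexMap_comp]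
    exact h

lemma sum_antidiagonal_assoc {M : Type*} [AddCommMonoid M] (f : ℕ → ℕ → ℕ → M) (n : ℕ) :
    ∑ x ∈ Finset.HasAntidiagonal.antidiagonal n,
        ∑ y ∈ Finset.HasAntidiagonal.antidiagonal x.1, f y.1 y.2 x.2 =
      ∑ x ∈ Finset.HasAntidiagonal.antidiagonal n,
        ∑ y ∈ Finset.HasAntidiagonal.antidiagonal x.2, f x.1 y.1 y.2 := by
  rw [Finset.sum_sigma', Finset.sum_sigma']
  refine Finset.sum_nbij' (fun x => ⟨(x.2.1, x.2.2 + x.1.2), (x.2.2, x.1.2)⟩)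
    (fun x => ⟨(x.1.1 + x.2.1, x.2.2), (x.1.1, x.2.1)⟩) ?_ ?_ ?_ ?_ ?_
  · rintro ⟨⟨a, b⟩, ⟨c, e⟩⟩ h
    simp only [Finset.mem_sigma, Finset.HasAntidiagonal.mem_antidiagonal] at h ⊢
    refine ⟨?_, trivial⟩
    omega
  · rintro ⟨⟨a, b⟩, ⟨c, e⟩⟩ h
    simp only [Finset.mem_sigma, Finset.HasAntidiagonal.mem_antidiagonal] at h ⊢
    refine ⟨?_, trivial⟩
    omega
  · rintro ⟨⟨a, b⟩, ⟨c, e⟩⟩ h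
    simp only [Finset.mem_sigma, Finset.HasAntidiagonal.mem_antidiagonal] at h ⊢
    rw [h.2]
  · rintro ⟨⟨a, b⟩, ⟨c, e⟩⟩ h
    simp only [Finset.mem_sigma, Finset.HasAntidiagonal.mem_antidiagonal] at h ⊢
    rw [h.2]
  · rintro ⟨⟨a, b⟩, ⟨c, e⟩⟩ h
    rfl

/-- The vertices `i < ⋯ < i + j` of the `n`-simplex. -/
def middleVertices (i j n : ℕ) (t : Fin (j + 1)) : Fin (n + 1) :=
  ⟨min (i + t) n, by omega⟩

/-- Both sides are the sum over front, middle and back faces. Strict associativity makes the Massey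
cochain a cocycle. -/
lemma cup_assoc (a b c : Cochains R X) :
    Cochains.cup (Cochains.cup a b) c = Cochains.cup a (Cochains.cup b c) := by
  funext n σ
  rw [cup_apply, cup_apply]
  simp only [cup_apply, Finset.sum_mul, Finset.mul_sum, ContinuousMap.comp_assoc, simplexMap_comp]
  refine Eq.trans (Finset.sum_congr rfl fun x hx => Finset.sum_congr rfl fun y hy => ?_)
    ((sum_antidiagonal_assoc (fun i j k => a i (σ.comp (simplexMap (frontVertices i n))) *
      b j (σ.comp (simplexMap (middleVertices i j n))) *
      c k (σ.comp (simplexMap (backVertices k n)))) n).trans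
    (Finset.sum_congr rfl fun x hx => Finset.sum_congr rfl fun y hy => ?_))
  · obtain ⟨x, k⟩ := x
    obtain ⟨i, j⟩ := y
    rw [Finset.HasAntidiagonal.mem_antidiagonal] at hx hy
    dsimp only at hx hy ⊢
    have e₁ : frontVertices x n ∘ frontVertices i x = frontVertices i n := by
      funext t
      ext
      grind [frontVertices]
    have e₂ : frontVertices x n ∘ backVertices j x = middleVertices i j n := by
      funext t
      ext
      grind [frontVertices, backVertices, middleVertices]
    rw [e₁, e₂]
  · obtain ⟨i, x⟩ := x
    obtain ⟨j, k⟩ := y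
    rw [Finset.HasAntidiagonal.mem_antidiagonal] at hx hy
    dsimp only at hx hy ⊢
    have e₁ : backVertices x n ∘ backVertices k x = backVertices k n := by
      funext t
      ext
      grind [backVertices]
    have e₂ : backVertices x n ∘ frontVertices j x = middleVertices i j n := by
      funext t
      ext
      grind [frontVertices, backVertices, middleVertices]
    rw [e₁, e₂, mul_assoc]

lemma VanishesOn.cup_left {a : Cochains R X} {U : Set X} (ha : VanishesOn a U)
    (b : Cochains R X) : VanishesOn (Cochains.cup a b) U := by
  intro n σ hσ
  rw [cup_apply]
  exact Finset.sum_eq_zero fun x _ => by rw [ha x.1 (σ.comp _) fun y => hσ _, zero_mul]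

lemma VanishesOn.cup_right {b : Cochains R X} {U : Set X} (hb : VanishesOn b U)
    (a : Cochains R X) : VanishesOn (Cochains.cup a b) U := by
  intro n σ hσ
  rw [cup_apply]
  exact Finset.sum_eq_zero fun x _ => by rw [hb x.2 (σ.comp _) fun y => hσ _, mul_zero]

/-- The inclusion of a subspace. -/
def inclusionMap (U : Set X) : C(U, X) := ⟨Subtype.val, continuous_subtype_val⟩

open Classical in
/-- Extension of a cochain on a subspace by zero. -/
noncomputable def extendByZero {U : Set X} (e : Cochains R U) : Cochains R X := fun n σ =>
  if h : ∀ x, σ x ∈ U then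
    e n ⟨fun x => ⟨σ x, h x⟩, Continuous.subtype_mk σ.continuous h⟩ else 0

lemma extendByZero_mem_deg {U : Set X} {k : ℤ} {e : Cochains R U} (he : e ∈ deg R U k) :
    extendByZero e ∈ deg R X k := by
  intro n hn
  funext σ
  simp [extendByZero, he n hn]

lemma pullback_extendByZero {U : Set X} (e : Cochains R U) :
    pullback (inclusionMap U) (extendByZero e) = e := by
  funext n σ
  exact dif_pos fun x => (σ x).2

lemma vanishesOn_of_pullback_eq_zero {U : Set X} {c : Cochains R X}
    (hc : pullback (inclusionMap U) c = 0) : VanishesOn c U := fun n σ hσ =>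
  congrFun (congrFun hc n) ⟨fun x => ⟨σ x, hσ x⟩, Continuous.subtype_mk σ.continuous hσ⟩

lemma Cohomology.mk_eq_zero_iff {k : ℤ} (z : cocycles R X k) :
    Cohomology.mk z = 0 ↔ z.1 ∈ coboundaries R X k :=
  Submodule.Quotient.mk_eq_zero _

lemma Cohomology.map_mk_eq_zero_iff {A : Type u} [TopologicalSpace A] (f : C(A, X)) {k : ℤ}
    (z : cocycles R X k) :
    Cohomology.map (R := R) f k (Cohomology.mk z) = 0 ↔ pullback f z.1 ∈ coboundaries R A k :=
  Submodule.Quotient.mk_eq_zero _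

/-- A class vanishing on a subspace has a representative vanishing on the subspace. -/
lemma exists_mk_eq_vanishesOn {k : ℤ} (u : Cohomology R X k) {U : Set X}
    (hu : Cohomology.map (R := R) (inclusionMap U) k u = 0) :
    ∃ a : cocycles R X k, Cohomology.mk a = u ∧ VanishesOn a.1 U := by
  obtain ⟨a, rfl⟩ := Submodule.Quotient.mk_surjective _ u
  obtain ⟨e, he, hea⟩ := (Cohomology.map_mk_eq_zero_iff _ a).mp hu
  have hd : d (extendByZero e) ∈ coboundaries R X k := ⟨_, extendByZero_mem_deg he, rfl⟩
  have hdeg : d (extendByZero e) ∈ deg R X k := by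
    intro n hn
    funext σ
    cases n with
    | zero => rfl
    | succ n =>
      rw [d_succ]
      refine Finset.sum_eq_zero fun i _ => ?_
      rw [extendByZero_mem_deg he n (by push_cast at hn; omega), Pi.zero_apply, mul_zero]
  -- On `U` the cocycle `a` is `d e`, so subtracting the coboundary of any extension of `e` kills it
  -- there.
  refine ⟨a - ⟨d (extendByZero e), hdeg, d_d _⟩, ?_, vanishesOn_of_pullback_eq_zero ?_⟩
  · refine (Cohomology.mk_eq_mk_iff _ _).mpr ?_
    change a.1 - d (extendByZero e) - a.1 ∈ _
    rw [sub_sub_cancel_left]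
    exact neg_mem hd
  · change pullback _ (a.1 - d (extendByZero e)) = 0
    rw [map_sub, ← d_pullback, pullback_extendByZero, hea, sub_self]

/-- If `B` is the union of two open sets, `β` vanishes on the first one and `α`, `γ` vanish on the
second one, then the Massey product contains `0`. -/
theorem zero_mem_masseyProduct {p q r : ℕ} (α : Cohomology R X p) (β : Cohomology R X q)
    (γ : Cohomology R X r) {V W : Set X} (hV : IsOpen V) (hW : IsOpen W)
    (hVW : V ∪ W = Set.univ) (hα : Cohomology.map (R := R) (inclusionMap W) p α = 0)
    (hβ : Cohomology.map (R := R) (inclusionMap V) q β = 0)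
    (hγ : Cohomology.map (R := R) (inclusionMap W) r γ = 0) : 0 ∈ masseyProduct α β γ := by
  obtain ⟨a, rfl, ha⟩ := exists_mk_eq_vanishesOn α hα
  obtain ⟨b, rfl, hb⟩ := exists_mk_eq_vanishesOn β hβ
  obtain ⟨c, rfl, hc⟩ := exists_mk_eq_vanishesOn γ hγ
  let U : Bool → Set X := fun t => cond t V W
  have hU : ∀ t, IsOpen (U t) := by
    rintro (_ | _)
    exacts [hW, hV]
  have hcov : ⋃ t, U t = Set.univ := by
    rw [← hVW, Set.union_eq_iUnion]
  have hab : ∀ t, VanishesOn (Cochains.cup a.1 b.1) (U t) := by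
    rintro (_ | _)
    exacts [ha.cup_left _, hb.cup_right _]
  have hbc : ∀ t, VanishesOn (Cochains.cup b.1 c.1) (U t) := by
    rintro (_ | _)
    exacts [hc.cup_right _, hb.cup_left _]
  obtain ⟨m, hm, hdm, hmU⟩ :=
    exists_d_eq_of_vanishesOn U hU hcov (cup_mem_cocycles a.2 b.2) hab
  obtain ⟨l, hl, hdl, hlU⟩ :=
    exists_d_eq_of_vanishesOn U hU hcov (cup_mem_cocycles b.2 c.2) hbc
  have hda : d a.1 = 0 := a.2.2
  have hdc : d c.1 = 0 := c.2.2
  have hz : Cochains.cup a.1 l + (-1 : R) ^ (p + 1) • Cochains.cup m c.1 ∈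
      cocycles R X (p + q + r - 1) := by
    refine ⟨add_mem ?_ (Submodule.smul_mem _ _ ?_), ?_⟩
    · convert cup_mem_deg a.2.1 hl using 2
      ring
    · convert cup_mem_deg hm c.2.1 using 2
      ring
    · change d (_ + _) = 0
      -- What remains is `(-1)^p a • b • c + (-1)^(p+1) a • b • c`. The inhomogeneous Leibniz rule
      -- is used for `m`, whose degree `p + q - 1` may be negative.
      rw [map_add, map_smul, d_cup a.2.1, d_cup_total m, hda, hdc, hdm, hdl, cup_assoc]
      simp [pow_succ]
  have hzU : ∀ t, VanishesOn (Cochains.cup a.1 l + (-1 : R) ^ (p + 1) • Cochains.cup m c.1)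
      (U t) := fun t n σ hσ => by
    change Cochains.cup a.1 l n σ + (-1 : R) ^ (p + 1) * Cochains.cup m c.1 n σ = 0
    rw [(hlU t).cup_right _ n σ hσ, (hmU t).cup_left _ n σ hσ, mul_zero, add_zero]
  obtain ⟨w, hw, hdw, -⟩ := exists_d_eq_of_vanishesOn U hU hcov hz hzU
  exact ⟨a, b, c, m, l, ⟨_, hz⟩, rfl, rfl, rfl, hm, hl, hdm, hdl, rfl,
    ((Cohomology.mk_eq_zero_iff _).mpr ⟨w, hw, hdw⟩).symm⟩

end CochainAlgebra

/-! ### The universal space with finitely many partial sections -/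

/-- The space `E` together with an additional closed point, the only neighbourhood of which is
the whole space. A continuous map to it is a continuous map to `E` on an open subset. -/
inductive PartialPoint (E : Type u) : Type u
  | none : PartialPoint E
  | some (e : E) : PartialPoint E

namespace PartialPoint

variable {E : Type u}

lemma some_injective : Function.Injective (some : E → PartialPoint E) :=
  fun _ _ => some.inj

variable [TopologicalSpace E] {X : Type*} [TopologicalSpace X]

instance : TopologicalSpace (PartialPoint E) where
  IsOpen U := (none ∈ U → U = Set.univ) ∧ IsOpen (some ⁻¹' U)
  isOpen_univ := ⟨fun _ => rfl, isOpen_univ⟩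
  isOpen_inter U V hU hV :=
    ⟨fun h => by rw [hU.1 h.1, hV.1 h.2, Set.univ_inter], hU.2.inter hV.2⟩
  isOpen_sUnion S hS := by
    refine ⟨fun ⟨U, hU, h⟩ => ?_, ?_⟩
    · have := (hS U hU).1 h
      exact Set.eq_univ_of_univ_subset (this ▸ Set.subset_sUnion_of_mem hU)
    · rw [Set.preimage_sUnion]
      exact isOpen_biUnion fun U hU => (hS U hU).2

lemma isOpen_iff {U : Set (PartialPoint E)} :
    IsOpen U ↔ (none ∈ U → U = Set.univ) ∧ IsOpen (some ⁻¹' U) := Iff.rfl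

lemma isOpen_image_some {O : Set E} (hO : IsOpen O) : IsOpen (some '' O) := by
  refine isOpen_iff.mpr ⟨fun ⟨e, _, h⟩ => by simp at h, ?_⟩
  rwa [Set.preimage_image_eq _ some_injective]

/-- Only the whole space is a neighbourhood of `none`, so continuity has to be checked only near
points mapped into `E`. -/
lemma continuous_of_eventually {g : X → PartialPoint E}
    (hg : ∀ x e, g x = some e → ∃ h : C(X, E), ∀ᶠ y in 𝓝 x, g y = some (h y)) :
    Continuous g := by
  refine continuous_def.mpr fun U hU => ?_
  by_cases hn : none ∈ U
  · rw [hU.1 hn, Set.preimage_univ]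
    exact isOpen_univ
  refine isOpen_iff_mem_nhds.mpr fun x hx => ?_
  obtain ⟨e, he⟩ : ∃ e, g x = some e := by
    cases h : g x with
    | none => exact absurd (h ▸ hx) hn
    | some e => exact ⟨e, rfl⟩
  obtain ⟨h, hh⟩ := hg x e he
  have hx' : h x ∈ some ⁻¹' U := by
    rw [Set.mem_preimage, ← hh.self_of_nhds]
    exact hx
  filter_upwards [hh, (hU.2.preimage h.continuous).mem_nhds hx'] with y hy hy'
  rw [Set.mem_preimage, hy]
  exact hy'

end PartialPoint

variable {E B : Type u} [TopologicalSpace E] [TopologicalSpace B]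

/-- The universal space over `B` that is covered by the domains of `N` partial sections of `p`. -/
def SectionSpace (p : C(E, B)) (N : ℕ) : Type u :=
  {x : B × (Fin N → PartialPoint E) //
    (∃ i e, x.2 i = .some e) ∧ ∀ i e, x.2 i = .some e → p e = x.1}

instance (p : C(E, B)) (N : ℕ) : TopologicalSpace (SectionSpace p N) :=
  inferInstanceAs (TopologicalSpace (Subtype _))

/-- The projection of `SectionSpace p N` to the base. -/
def SectionSpace.proj (p : C(E, B)) (N : ℕ) : C(SectionSpace p N, B) :=
  ⟨fun x => x.1.1, continuous_fst.comp continuous_subtype_val⟩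

/-- The `i`-th coordinate is itself a section over the set where it lies in `E`, and this set is
open because `E` is open in `PartialPoint E`. -/
lemma SectionSpace.hasSectionalCover (p : C(E, B)) (N : ℕ) :
    HasSectionalCover (pullbackFibration (SectionSpace.proj p N) p) N := by
  have hcont : ∀ i : Fin N, Continuous fun x : SectionSpace p N => x.1.2 i := fun i =>
    (continuous_apply i).comp (continuous_snd.comp continuous_subtype_val)
  refine ⟨fun i => {x | ∃ e, x.1.2 i = .some e}, fun i => ?_, ?_, fun i => ?_⟩
  · convert (PartialPoint.isOpen_image_some (isOpen_univ (X := E))).preimage (hcont i) using 1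
    ext x
    change (∃ e, x.1.2 i = .some e) ↔ ∃ e, e ∈ Set.univ ∧ PartialPoint.some e = x.1.2 i
    simp only [Set.mem_univ, true_and]
    exact exists_congr fun e => eq_comm
  · exact Set.eq_univ_of_forall fun x => Set.mem_iUnion.mpr x.2.1
  · have hs : ∀ x : {x : SectionSpace p N | ∃ e, x.1.2 i = .some e}, ∃ e, x.1.1.2 i = .some e :=
      fun x => x.2
    choose s hs using hs
    have hsc : Continuous s := by
      refine continuous_def.mpr fun O hO => ?_
      convert (PartialPoint.isOpen_image_some hO).preimage
        ((hcont i).comp continuous_subtype_val) using 1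
      ext x
      change s x ∈ O ↔ x.1.1.2 i ∈ PartialPoint.some '' O
      rw [hs x]
      exact PartialPoint.some_injective.mem_set_image.symm
    refine ⟨⟨fun x => ⟨(x.1, s x), (x.1.2.2 i _ (hs x)).symm⟩, ?_⟩, fun x => rfl⟩
    exact Continuous.subtype_mk (continuous_subtype_val.prodMk hsc) _

/-! ### Lifting singular simplices -/

/-- Paths in the base of `p` together with a lift of the starting point. -/
abbrev LiftingProblem (p : C(E, B)) : Type u := {x : E × C(unitInterval, B) // p x.1 = x.2 0}

/-- Paths in the base of a fibration can be lifted continuously; only the end points of the lifts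
are recorded. -/
lemma IsFibration.exists_transport {p : C(E, B)} (hp : IsFibration p) :
    ∃ T : C(LiftingProblem p, E), ∀ x, p (T x) = x.1.2 1 := by
  -- The homotopy lifting property for the universal case: evaluation of paths, with the given
  -- starting points as initial lift.
  obtain ⟨G, -, hG⟩ := hp (LiftingProblem p)
    ⟨fun z => z.1.1.2 z.2, by fun_prop⟩ ⟨fun z => z.1.1, by fun_prop⟩ fun y => y.2
  exact ⟨⟨fun x => G (x, 1), by fun_prop⟩, fun x => hG (x, 1)⟩

lemma IsFibration.surjective [Nonempty E] [PathConnectedSpace B] {p : C(E, B)}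
    (hp : IsFibration p) : Function.Surjective p := by
  intro b
  obtain ⟨T, hT⟩ := hp.exists_transport
  obtain ⟨e⟩ := ‹Nonempty E›
  obtain ⟨γ⟩ := PathConnectedSpace.joined (p e) b
  exact ⟨T ⟨(e, γ.toContinuousMap), γ.source.symm⟩, (hT _).trans γ.target⟩

/-- The straight line in a simplex from `y` to a variable point. -/
noncomputable def lineTo {m : ℕ} (y : stdSimplex ℝ (Fin (m + 1))) :
    C(stdSimplex ℝ (Fin (m + 1)) × unitInterval, stdSimplex ℝ (Fin (m + 1))) where
  toFun z := ⟨(1 - z.2.1) • y.1 + z.2.1 • z.1.1, convex_stdSimplex ℝ _ y.2 z.1.2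
    (sub_nonneg.mpr z.2.2.2) z.2.2.1 (sub_add_cancel _ _)⟩
  continuous_toFun := by fun_prop

lemma lineTo_zero {m : ℕ} (y x : stdSimplex ℝ (Fin (m + 1))) : lineTo y (x, 0) = y := by
  ext : 1
  change (1 - (0 : ℝ)) • y.1 + (0 : ℝ) • x.1 = y.1
  simp

lemma lineTo_one {m : ℕ} (y x : stdSimplex ℝ (Fin (m + 1))) : lineTo y (x, 1) = x := by
  ext : 1
  change (1 - (1 : ℝ)) • y.1 + (1 : ℝ) • x.1 = x.1
  simp

lemma simplexMap_lineTo {m n : ℕ} (f : Fin (m + 1) → Fin (n + 1))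
    (y x : stdSimplex ℝ (Fin (m + 1))) (s : unitInterval) :
    simplexMap f (lineTo y (x, s)) = lineTo (simplexMap f y) (simplexMap f x, s) := by
  ext : 1
  change FunOnFinite.linearMap ℝ ℝ f ((1 - s.1) • y.1 + s.1 • x.1) = _
  rw [map_add, map_smul, map_smul]
  rfl

/-- The points of a simplex at which the coordinates with index in `S` are positive and larger
than the others: the open star of the barycentre of the face `S` in the barycentric
subdivision. -/
def openStar {m : ℕ} (S : Finset (Fin (m + 1))) : Set (stdSimplex ℝ (Fin (m + 1))) :=
  {x | ∀ i ∈ S, 0 < x i ∧ ∀ j ∉ S, x j < x i}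

lemma isOpen_openStar {m : ℕ} (S : Finset (Fin (m + 1))) : IsOpen (openStar S) := by
  have hc : ∀ i, Continuous fun x : stdSimplex ℝ (Fin (m + 1)) => x i := fun i =>
    (continuous_apply i).comp continuous_subtype_val
  have : openStar S = ⋂ i ∈ S, ({x | 0 < x i} ∩ ⋂ j ∈ Sᶜ, {x | x j < x i}) := by
    ext x
    simp [openStar]
  rw [this]
  exact isOpen_biInter_finset fun i _ => (isOpen_lt continuous_const (hc i)).inter
    (isOpen_biInter_finset fun j _ => isOpen_lt (hc j) (hc i))

/-- Distinct sets of equal size each contain an index missing from the other, giving opposite strict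
inequalities. So stars of faces of one dimension are disjoint and can share one partial section. -/
lemma eq_of_mem_openStar {m : ℕ} {S T : Finset (Fin (m + 1))} {x : stdSimplex ℝ (Fin (m + 1))}
    (hS : x ∈ openStar S) (hT : x ∈ openStar T) (h : S.card = T.card) : S = T := by
  by_contra hne
  obtain ⟨i, hi, hi'⟩ := Finset.not_subset.mp fun hs =>
    hne (Finset.eq_of_subset_of_card_le hs h.ge)
  obtain ⟨j, hj, hj'⟩ := Finset.not_subset.mp fun hs =>
    hne (Finset.eq_of_subset_of_card_le hs h.le).symm
  exact lt_asymm ((hS i hi).2 j hj') ((hT j hj).2 i hi')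

lemma exists_mem_openStar {m : ℕ} (x : stdSimplex ℝ (Fin (m + 1))) :
    ∃ S : Finset (Fin (m + 1)), S.Nonempty ∧ x ∈ openStar S := by
  -- The support of `x`; it is non-empty since the coordinates sum to `1`.
  refine ⟨Finset.univ.filter fun i => 0 < x i, ?_, fun i hi => ?_⟩
  · by_contra h
    rw [Finset.not_nonempty_iff_eq_empty, Finset.filter_eq_empty_iff] at h
    have : ∑ i, x i ≤ 0 := Finset.sum_nonpos fun i hi => not_lt.mp (h hi)
    rw [stdSimplex.sum_eq_one] at this
    linarith
  · simp only [Finset.mem_filter, Finset.mem_univ, true_and, not_lt] at hi ⊢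
    exact ⟨hi, fun j hj => hj.trans_lt hi⟩

lemma simplexMap_apply_of_injective {m n : ℕ} (f : Fin (m + 1) ↪ Fin (n + 1))
    (x : stdSimplex ℝ (Fin (m + 1))) (i : Fin (m + 1)) : simplexMap f x (f i) = x i := by
  rw [simplexMap_apply]
  simp [Finset.filter_eq']

lemma simplexMap_apply_of_notMem {m n : ℕ} (f : Fin (m + 1) ↪ Fin (n + 1))
    (x : stdSimplex ℝ (Fin (m + 1))) {t : Fin (n + 1)} (ht : t ∉ Set.range f) :
    simplexMap f x t = 0 := by
  rw [simplexMap_apply]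
  refine Finset.sum_eq_zero fun i hi => absurd ⟨i, (Finset.mem_filter.mp hi).2⟩ ht

lemma simplexMap_mem_openStar_map {m n : ℕ} (f : Fin (m + 1) ↪ Fin (n + 1))
    {x : stdSimplex ℝ (Fin (m + 1))} {S : Finset (Fin (m + 1))} :
    simplexMap f x ∈ openStar (S.map f) ↔ x ∈ openStar S := by
  constructor
  · intro h i hi
    have := h (f i) (Finset.mem_map_of_mem f hi)
    rw [simplexMap_apply_of_injective] at this
    refine ⟨this.1, fun j hj => ?_⟩
    have := this.2 (f j) (by simpa using hj)
    rwa [simplexMap_apply_of_injective] at this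
  · intro h t ht
    obtain ⟨i, hi, rfl⟩ := Finset.mem_map.mp ht
    rw [simplexMap_apply_of_injective]
    refine ⟨(h i hi).1, fun t ht' => ?_⟩
    by_cases hr : t ∈ Set.range f
    · obtain ⟨j, rfl⟩ := hr
      rw [simplexMap_apply_of_injective]
      exact (h i hi).2 j (by simpa using ht')
    · rw [simplexMap_apply_of_notMem f x hr]
      exact (h i hi).1

/-- Coordinates off the face are zero, whereas those in `S` are positive: only stars of subfaces
meet a face. -/
lemma exists_map_eq_of_simplexMap_mem_openStar {m n : ℕ} (f : Fin (m + 1) ↪ Fin (n + 1))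
    {x : stdSimplex ℝ (Fin (m + 1))} {S : Finset (Fin (n + 1))}
    (h : simplexMap f x ∈ openStar S) : ∃ S' : Finset (Fin (m + 1)), S'.map f = S := by
  refine ⟨Finset.univ.filter fun i => f i ∈ S, ?_⟩
  ext t
  simp only [Finset.mem_map, Finset.mem_filter, Finset.mem_univ, true_and]
  refine ⟨fun ⟨i, hi, hit⟩ => hit ▸ hi, fun ht => ?_⟩
  by_cases hr : t ∈ Set.range f
  · obtain ⟨i, rfl⟩ := hr
    exact ⟨i, ht, rfl⟩
  · have := (h t ht).1
    rw [simplexMap_apply_of_notMem f x hr] at this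
    exact absurd this (lt_irrefl 0)

/-- The barycentre of the face `S`. -/
noncomputable def faceBary {m : ℕ} (S : Finset (Fin (m + 1))) (hS : S.Nonempty) :
    stdSimplex ℝ (Fin (m + 1)) :=
  ⟨fun i => if i ∈ S then (S.card : ℝ)⁻¹ else 0, fun i => by dsimp only; split <;> positivity, by
    have : (S.card : ℝ) ≠ 0 := by exact_mod_cast hS.card_pos.ne'
    simp [Finset.sum_ite_mem, this]⟩

lemma simplexMap_faceBary {m n : ℕ} (f : Fin (m + 1) ↪ Fin (n + 1)) (S : Finset (Fin (m + 1)))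
    (hS : S.Nonempty) : simplexMap f (faceBary S hS) = faceBary (S.map f) (hS.map) := by
  ext t
  change _ = if t ∈ S.map f then ((S.map f).card : ℝ)⁻¹ else 0
  by_cases hr : t ∈ Set.range f
  · obtain ⟨i, rfl⟩ := hr
    rw [simplexMap_apply_of_injective]
    change (if i ∈ S then (S.card : ℝ)⁻¹ else 0) = _
    simp
  · rw [simplexMap_apply_of_notMem f _ hr, if_neg]
    intro ht
    obtain ⟨i, -, rfl⟩ := Finset.mem_map.mp ht
    exact hr ⟨i, rfl⟩

/-- The image of the straight lines starting at `y` under a simplex, with a lift of the common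
starting point. -/
noncomputable def radialPath {p : C(E, B)} {c : B → E} (hc : ∀ b, p (c b) = b) {m : ℕ}
    (σ : SingularSimplex B m) (y : stdSimplex ℝ (Fin (m + 1))) :
    C(stdSimplex ℝ (Fin (m + 1)), LiftingProblem p) where
  toFun x := ⟨(c (σ y), (σ.comp (lineTo y)).curry x),
    (hc _).trans (congrArg σ (lineTo_zero y x)).symm⟩
  continuous_toFun :=
    Continuous.subtype_mk (continuous_const.prodMk (σ.comp (lineTo y)).curry.continuous) _

/-- The lift of a simplex obtained by transport along the straight lines starting at `y`. -/
noncomputable def radialLift {p : C(E, B)} (T : C(LiftingProblem p, E)) {c : B → E}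
    (hc : ∀ b, p (c b) = b) {m : ℕ} (σ : SingularSimplex B m) (y : stdSimplex ℝ (Fin (m + 1))) :
    C(stdSimplex ℝ (Fin (m + 1)), E) :=
  T.comp (radialPath hc σ y)

/-! ### Lifting simplices to the universal space, compatibly with faces. -/

section Lift

variable {p : C(E, B)} {T : C(LiftingProblem p, E)}
  {c : B → E} (hc : ∀ b, p (c b) = b)

lemma radialLift_spec (hT : ∀ x, p (T x) = x.1.2 1) {m : ℕ} (σ : SingularSimplex B m)
    (y x : stdSimplex ℝ (Fin (m + 1))) : p (radialLift T hc σ y x) = σ x :=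
  (hT _).trans (congrArg σ (lineTo_one y x))

lemma radialLift_simplexMap {m n : ℕ} (σ : SingularSimplex B n) (f : Fin (m + 1) → Fin (n + 1))
    (y x : stdSimplex ℝ (Fin (m + 1))) :
    radialLift T hc (σ.comp (simplexMap f)) y x =
      radialLift T hc σ (simplexMap f y) (simplexMap f x) := by
  refine congrArg T (Subtype.ext (Prod.ext rfl (ContinuousMap.ext fun s => ?_)))
  exact congrArg σ (simplexMap_lineTo f y x s)

open Classical in
/-- The partial lifts of a simplex over the open stars of the barycentres of its
`i`-dimensional faces. -/
noncomputable def starLift (T : C(LiftingProblem p, E))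
    (hc : ∀ b, p (c b) = b) {m : ℕ} (σ : SingularSimplex B m) (i : ℕ)
    (x : stdSimplex ℝ (Fin (m + 1))) : PartialPoint E :=
  if h : ∃ S : Finset (Fin (m + 1)), S.card = i + 1 ∧ x ∈ openStar S then
    .some (radialLift T hc σ
      (faceBary h.choose (Finset.card_pos.mp (by rw [h.choose_spec.1]; omega))) x)
  else .none

lemma starLift_of_mem {m : ℕ} (σ : SingularSimplex B m) {i : ℕ} {x : stdSimplex ℝ (Fin (m + 1))}
    {S : Finset (Fin (m + 1))} (hS : S.Nonempty) (hi : S.card = i + 1) (hx : x ∈ openStar S) :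
    starLift T hc σ i x = .some (radialLift T hc σ (faceBary S hS) x) := by
  have h : ∃ S : Finset (Fin (m + 1)), S.card = i + 1 ∧ x ∈ openStar S := ⟨S, hi, hx⟩
  have e : h.choose = S :=
    eq_of_mem_openStar h.choose_spec.2 hx (h.choose_spec.1.trans hi.symm)
  rw [starLift, dif_pos h]
  simp only [e]

lemma starLift_of_not {m : ℕ} (σ : SingularSimplex B m) {i : ℕ} {x : stdSimplex ℝ (Fin (m + 1))}
    (h : ¬∃ S : Finset (Fin (m + 1)), S.card = i + 1 ∧ x ∈ openStar S) :
    starLift T hc σ i x = .none := dif_neg h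

lemma exists_of_starLift_eq_some {m : ℕ} {σ : SingularSimplex B m} {i : ℕ}
    {x : stdSimplex ℝ (Fin (m + 1))} {e : E} (h : starLift T hc σ i x = .some e) :
    ∃ (S : Finset (Fin (m + 1))) (hS : S.Nonempty), S.card = i + 1 ∧ x ∈ openStar S ∧
      e = radialLift T hc σ (faceBary S hS) x := by
  by_cases h' : ∃ S : Finset (Fin (m + 1)), S.card = i + 1 ∧ x ∈ openStar S
  · obtain ⟨S, hi, hx⟩ := h'
    have hS : S.Nonempty := Finset.card_pos.mp (by omega)
    rw [starLift_of_mem hc σ hS hi hx] at h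
    exact ⟨S, hS, hi, hx, (PartialPoint.some.inj h).symm⟩
  · rw [starLift_of_not hc σ h'] at h
    exact absurd h (by simp)

lemma continuous_starLift {m : ℕ} (σ : SingularSimplex B m) (i : ℕ) :
    Continuous (starLift T hc σ i) := by
  refine PartialPoint.continuous_of_eventually fun x e he => ?_
  obtain ⟨S, hS, hi, hx, -⟩ := exists_of_starLift_eq_some hc he
  refine ⟨radialLift T hc σ (faceBary S hS), ?_⟩
  filter_upwards [(isOpen_openStar S).mem_nhds hx] with y hy
  exact starLift_of_mem hc σ hS hi hy

/-- Stars, barycentres and straight lines all restrict to faces, and the starting lift `c (σ y)`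
depends only on the point of `B`. This makes the lifts commute with face maps. -/
lemma starLift_simplexMap {m n : ℕ} (σ : SingularSimplex B n) (f : Fin (m + 1) ↪ Fin (n + 1))
    (i : ℕ) (x : stdSimplex ℝ (Fin (m + 1))) :
    starLift T hc (σ.comp (simplexMap f)) i x = starLift T hc σ i (simplexMap f x) := by
  by_cases h : ∃ S : Finset (Fin (m + 1)), S.card = i + 1 ∧ x ∈ openStar S
  · obtain ⟨S, hi, hx⟩ := h
    have hS : S.Nonempty := Finset.card_pos.mp (by omega)
    rw [starLift_of_mem hc _ hS hi hx, starLift_of_mem hc σ hS.map (by rwa [Finset.card_map])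
      ((simplexMap_mem_openStar_map f).mpr hx), radialLift_simplexMap, simplexMap_faceBary]
  · rw [starLift_of_not hc _ h, starLift_of_not hc]
    rintro ⟨S, hi, hx⟩
    obtain ⟨S, rfl⟩ := exists_map_eq_of_simplexMap_mem_openStar f hx
    exact h ⟨S, by rwa [Finset.card_map] at hi, (simplexMap_mem_openStar_map f).mp hx⟩

lemma starLift_spec (hT : ∀ x, p (T x) = x.1.2 1) {m n : ℕ} (hmn : m ≤ n)
    (σ : SingularSimplex B m) (x : stdSimplex ℝ (Fin (m + 1))) :
    (∃ (i : Fin (n + 1)) (e : E), starLift T hc σ i x = .some e) ∧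
      ∀ (i : Fin (n + 1)) (e : E), starLift T hc σ i x = .some e → p e = σ x := by
  constructor
  · obtain ⟨S, hS, hx⟩ := exists_mem_openStar x
    have h₁ := hS.card_pos
    have h₂ := S.card_le_univ
    rw [Fintype.card_fin] at h₂
    -- A face has at most `m + 1 ≤ n + 1` vertices, so `n + 1` partial sections suffice.
    exact ⟨⟨S.card - 1, by omega⟩, _,
      starLift_of_mem hc σ hS (Nat.sub_add_cancel h₁).symm hx⟩
  · intro i e he
    obtain ⟨S, hS, -, -, rfl⟩ := exists_of_starLift_eq_some hc he
    exact radialLift_spec hc hT σ _ x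

/-- The lift of a simplex of dimension at most `n` to the universal space. -/
noncomputable def simplexLift (hT : ∀ x, p (T x) = x.1.2 1) {m n : ℕ} (hmn : m ≤ n)
    (σ : SingularSimplex B m) : SingularSimplex (SectionSpace p (n + 1)) m where
  toFun x := ⟨(σ x, fun i => starLift T hc σ i x), starLift_spec hc hT hmn σ x⟩
  continuous_toFun := Continuous.subtype_mk (σ.continuous.prodMk
    (continuous_pi fun i : Fin (n + 1) => continuous_starLift hc σ (i : ℕ))) _

lemma simplexLift_comp (hT : ∀ x, p (T x) = x.1.2 1) {m m' n : ℕ} (hm : m ≤ n) (hm' : m' ≤ n)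
    (σ : SingularSimplex B m) (f : Fin (m' + 1) ↪ Fin (m + 1)) :
    (simplexLift hc hT hm σ).comp (simplexMap f) =
      simplexLift hc hT hm' (σ.comp (simplexMap f)) := by
  ext x : 1
  refine Subtype.ext (Prod.ext rfl (funext fun i => ?_))
  exact (starLift_simplexMap hc σ f i x).symm

end Lift

/-- Cohomology in degree `n` embeds into that of the universal space with `n + 1` partial
sections. -/
theorem eq_zero_of_map_proj_eq_zero {R : Type v} [CommRing R] [Nonempty E] [PathConnectedSpace B]
    {p : C(E, B)} (hp : IsFibration p) {n : ℕ} (u : Cohomology R B n)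
    (hu : Cohomology.map (R := R) (SectionSpace.proj p (n + 1)) n u = 0) : u = 0 := by
  obtain ⟨T, hT⟩ := hp.exists_transport
  choose c hc using hp.surjective
  obtain ⟨z, rfl⟩ := Submodule.Quotient.mk_surjective _ u
  obtain ⟨v, hv, hvz⟩ := (Cohomology.map_mk_eq_zero_iff _ z).mp hu
  -- The pull-back of `v` along the lifts. The value `0` above dimension `n` is harmless, as `v` has
  -- degree `n - 1`.
  let w : Cochains R B := fun m τ => if h : m ≤ n then v m (simplexLift hc hT h τ) else 0
  have hw : w ∈ deg R B (n - 1) := by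
    intro m hm
    funext τ
    by_cases h : m ≤ n
    · exact (dif_pos h).trans (congrFun (hv m hm) _)
    · exact dif_neg h
  refine (Cohomology.mk_eq_zero_iff z).mpr ⟨w, hw, ?_⟩
  funext m σ
  by_cases h : m ≤ n
  · refine Eq.trans ?_ (congrFun (congrFun hvz m) (simplexLift hc hT h σ))
    cases m with
    | zero => rfl
    | succ m =>
      rw [d_succ, d_succ]
      refine Finset.sum_congr rfl fun k _ => ?_
      have h' : m ≤ n := by omega
      congr 1
      refine (dif_pos h').trans (congrArg _ ?_)
      exact (simplexLift_comp hc hT h h' σ k.succAboveEmb).symm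
  · rw [z.2.1 m (by omega)]
    cases m with
    | zero => rfl
    | succ m =>
      rw [d_succ]
      refine Finset.sum_eq_zero fun k _ => ?_
      rw [hw m (by omega), Pi.zero_apply, mul_zero]

/-! ### Weights -/

section Weight

variable {E B : Type u} [TopologicalSpace E] [TopologicalSpace B]

lemma genus_le {p : C(E, B)} {k : ℕ} (h : HasSectionalCover p k) : genus p ≤ k :=
  iInf₂_le k h

lemma exists_hasSectionalCover {p : C(E, B)} {k : ℕ} (h : genus p ≤ k) :
    ∃ j ≤ k, HasSectionalCover p j := by
  by_contra! hn
  have : ((k + 1 : ℕ) : ℕ∞) ≤ genus p := le_iInf₂ fun j hj => by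
    refine Nat.cast_le.mpr (not_lt.mp fun hlt => hn j (Nat.lt_succ_iff.mp hlt) hj)
  have := Nat.cast_le.mp (this.trans h)
  omega

variable {R : Type v} [CommRing R] {p : C(E, B)} {n : ℤ} {u : Cohomology R B n}

/-- The defining condition passes to smaller `k`, so a failure would bound the weight by the
predecessor of `k`. -/
lemma map_eq_zero_of_le_wgt {k : ℕ} (hk : (k : ℕ∞) ≤ wgt p u) {A : Type u} [TopologicalSpace A]
    (f : C(A, B)) (hf : genus (pullbackFibration f p) ≤ k) :
    Cohomology.map (R := R) f n u = 0 := by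
  by_cases h : ∃ k' ≥ k, ∀ (A : Type u) [TopologicalSpace A] (f : C(A, B)),
      genus (pullbackFibration f p) ≤ k' → Cohomology.map (R := R) f n u = 0
  · obtain ⟨k', hk', h⟩ := h
    exact h A f (hf.trans (Nat.cast_le.mpr hk'))
  push Not at h
  have hlt : ∀ k' : ℕ, (∀ (A : Type u) [TopologicalSpace A] (f : C(A, B)),
      genus (pullbackFibration f p) ≤ k' → Cohomology.map (R := R) f n u = 0) → k' < k :=
    fun k' h' => not_le.mp fun hle => by
      obtain ⟨A, _, f, hf, hne⟩ := h k' hle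
      exact hne (h' A f hf)
  cases k with
  | zero =>
    -- Genus zero forces `A` to be empty, and an empty space has no singular simplices.
    obtain ⟨j, hj, U, -, hcov, -⟩ := exists_hasSectionalCover hf
    have hA : IsEmpty A := ⟨fun x => by
      obtain ⟨i, -⟩ := Set.mem_iUnion.mp (hcov.ge (Set.mem_univ x))
      exact absurd i.2 (by omega)⟩
    obtain ⟨z, rfl⟩ := Submodule.Quotient.mk_surjective _ u
    refine (Cohomology.map_mk_eq_zero_iff f z).mpr ?_
    convert zero_mem (coboundaries R A n)
    funext m σ
    exact (hA.false (σ (Classical.arbitrary _))).elim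
  | succ k =>
    have : wgt p u ≤ k := iSup₂_le fun k' h' => Nat.cast_le.mpr (Nat.lt_succ_iff.mp (hlt k' h'))
    have := Nat.cast_le.mp (hk.trans this)
    omega

/-- A non-zero class has finite weight. -/
lemma eq_zero_of_wgt_eq_top [Nonempty E] [PathConnectedSpace B] (hp : IsFibration p) {n : ℕ}
    (u : Cohomology R B n) (hu : wgt p u = ⊤) : u = 0 :=
  eq_zero_of_map_proj_eq_zero hp u (map_eq_zero_of_le_wgt (k := n + 1) (hu ▸ le_top) _
    (genus_le (SectionSpace.hasSectionalCover p (n + 1))))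

/-- A class vanishes on a union of at most `wgt p u` open sets with local sections. -/
lemma map_inclusionMap_eq_zero {ι : Type*} [Fintype ι] {U : ι → Set B} (hU : ∀ i, IsOpen (U i))
    (hs : ∀ i, ∃ s : C(U i, E), ∀ x : U i, p (s x) = x) (hk : (Fintype.card ι : ℕ∞) ≤ wgt p u) :
    Cohomology.map (R := R) (inclusionMap (⋃ i, U i)) n u = 0 := by
  refine map_eq_zero_of_le_wgt hk _ (genus_le ?_)
  let e := Fintype.equivFin ι
  choose s hs using hs
  refine ⟨fun j => Subtype.val ⁻¹' U (e.symm j),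
    fun j => (hU _).preimage continuous_subtype_val, ?_, fun j => ?_⟩
  · refine Set.eq_univ_of_forall fun x => ?_
    obtain ⟨i, hi⟩ := Set.mem_iUnion.mp x.2
    exact Set.mem_iUnion.mpr ⟨e i, by simpa using hi⟩
  · exact ⟨⟨fun x => ⟨(x.1, s (e.symm j) ⟨x.1.1, x.2⟩),
        (hs (e.symm j) ⟨x.1.1, x.2⟩).symm⟩,
      Continuous.subtype_mk (continuous_subtype_val.prodMk ((s (e.symm j)).continuous.comp
        (Continuous.subtype_mk (continuous_subtype_val.comp continuous_subtype_val) _))) _⟩,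
      fun x => rfl⟩

end Weight

end MasseyGenus


/-! ### The genus inequality. -/

theorem theorem3p1 {R : Type v} [CommRing R] {E B : Type u}
    [TopologicalSpace E] [TopologicalSpace B] [Nonempty E] [PathConnectedSpace B]
    (p : C(E, B)) (hp : IsFibration p) {i j k : ℕ}
    (α : Cohomology R B i) (β : Cohomology R B j) (γ : Cohomology R B k)
    (hdef : MasseyDefined α β γ) (hne : 0 ∉ masseyProduct α β γ) :
    wgt p β + min (wgt p α) (wgt p γ) < genus p := by
  by_contra! hle
  have hempty : ∀ {n : ℤ} (u : Cohomology R B n),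
      Cohomology.map (R := R) (inclusionMap (⋃ i : Fin 0, i.elim0)) n u = 0 := fun u =>
    map_inclusionMap_eq_zero (p := p) (fun i => i.elim0) (fun i => i.elim0) (by simp)
  by_cases hβ : wgt p β = ⊤
  · refine hne (zero_mem_masseyProduct α β γ isOpen_univ (isOpen_iUnion fun i => i.elim0)
      (Set.univ_union _) (hempty α) ?_ (hempty γ))
    rw [eq_zero_of_wgt_eq_top hp β hβ, map_zero]
  by_cases hαγ : min (wgt p α) (wgt p γ) = ⊤
  · obtain ⟨hα, hγ⟩ := min_eq_top.mp hαγ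
    refine hne (zero_mem_masseyProduct α β γ (isOpen_iUnion fun i => i.elim0) isOpen_univ
      (Set.union_univ _) ?_ (hempty β) ?_)
    · rw [eq_zero_of_wgt_eq_top hp α hα, map_zero]
    · rw [eq_zero_of_wgt_eq_top hp γ hγ, map_zero]
  obtain ⟨b, hb⟩ := ENat.ne_top_iff_exists.mp hβ
  obtain ⟨m, hm⟩ := ENat.ne_top_iff_exists.mp hαγ
  rw [← hb, ← hm, ← Nat.cast_add] at hle
  obtain ⟨N, hN, hcover⟩ := exists_hasSectionalCover hle
  obtain ⟨s, t, rfl, hs, ht⟩ : ∃ s t : ℕ, N = s + t ∧ s ≤ b ∧ t ≤ m :=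
    -- The cover may have fewer than `b + m` members; as many as `wgt p β` permits go to `V`.
    ⟨min N b, N - min N b, by omega, by omega, by omega⟩
  obtain ⟨U, hU, hcov, hsec⟩ := hcover
  have hsβ : (Fintype.card (Fin s) : ℕ∞) ≤ wgt p β := by
    rw [Fintype.card_fin, ← hb]
    exact_mod_cast hs
  have htαγ : (Fintype.card (Fin t) : ℕ∞) ≤ min (wgt p α) (wgt p γ) := by
    rw [Fintype.card_fin, ← hm]
    exact_mod_cast ht
  refine hne (zero_mem_masseyProduct α β γ
    (V := ⋃ i : Fin s, U (Fin.castAdd t i)) (W := ⋃ i : Fin t, U (Fin.natAdd s i))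
    (isOpen_iUnion fun i => hU _) (isOpen_iUnion fun i => hU _) ?_
    (map_inclusionMap_eq_zero (fun i => hU _) (fun i => hsec _) (htαγ.trans (min_le_left _ _)))
    (map_inclusionMap_eq_zero (fun i => hU _) (fun i => hsec _) hsβ)
    (map_inclusionMap_eq_zero (fun i => hU _) (fun i => hsec _) (htαγ.trans (min_le_right _ _))))
  refine Set.eq_univ_of_forall fun x => ?_
  obtain ⟨i, hi⟩ := Set.mem_iUnion.mp (hcov.ge (Set.mem_univ x))
  cases i using Fin.addCases with
  | left i => exact Or.inl (Set.mem_iUnion.mpr ⟨i, hi⟩)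
  | right i => exact Or.inr (Set.mem_iUnion.mpr ⟨i, hi⟩)
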